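/- Let $t_1,\dots,t_N\in\mathbb{R}$ be measurement times, and consider measurement settings $x\in\{1,\dots,X\}$ with outcomes $a\in\{1,\dots,A\}$, $A\ge 1$. A *dataset* is a family of numbers $P(a|x,t_j)\ge 0$ with $\sum_a P(a|x,t_j)=1$ for all $x,j$. A *quantum realization* of $P$ is a tuple $(\mathcal H,\rho,H,M)$ consisting of a complex Hilbert space $\mathcal H$, a density operator $\rho$ on $\mathcal H$, a (possibly unbounded) self-adjoint operator $H\ge 0$ and POVMs $(M_{a|x})_a$ on $\mathcal H$ (that is, $M_{a|x}\ge 0$ and $\sum_a M_{a|x}=\mathbb I$ for every $x$), such that $$P(a|x,t_j)=\operatorname{tr}\left(e^{-iHt_j}\rho\, e^{iHt_j}M_{a|x}\right)\quad\text{for all } a,x,j.$$ Let $E^+,\epsilon\in\mathbb{R}$ and $\vec E=(E_0,\dots,E_{m-1})$ with $0\le E_k<E^+$ for all $k$. Let $S(\vec E;E^+,\epsilon,\vec t)$ be the set of datasets that have a quantum realization with $\operatorname{spec}(H)\cap[0,E^+)=\{E_0,\dots,E_{m-1}\}$ and $\operatorname{tr}\left(\rho\,\Pi_H([E^+,\infty))\right)\le\epsilon$,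 where $\Pi_H$ is the spectral measure of $H$; the second condition says that the energy distribution of $\rho$ has weight at most $\epsilon$ on $[E^+,\infty)$. For $E'\in\mathbb{R}\cup\{-\infty\}$ let $G(E',\vec t)$ be the closure of the cone of $N\times N$ complex matrices $\gamma$ of the form $$\gamma_{jk}=\int_{[E',\infty)}e^{-iE(t_k-t_j)}\,d\mu(E),\qquad j,k=1,\dots,N,$$ with $\mu$ a finite positive Borel measure on $\mathbb{R}$ (for $E'=-\infty$ the integral is over all of $\mathbb{R}$). The set of *decay matrices* is $G(\vec t):=G(-\infty,\vec t)$. Let $|0\rangle,\dots,|m+N-1\rangle$ be the standard basis of $\mathbb{C}^{m}\oplus\mathbb{C}^{N}$ and put $$|\tilde\psi_j\rangle:=\sum_{k=0}^{m-1}e^{-iE_kt_j}|k\rangle+|m+j-1\rangle,\qquad j=1,\dots,N.$$ Then the following hold. (1) A dataset $P$ belongs to the closure $\overline{S(\vec E;E^+,\epsilon,\vec t)}$ if and only if there exist a probability distribution $(p_0,\dots,p_m)$, a matrix $\gamma\in G(\vec t)$ and $(m+N)\times(m+N)$ complex matrices $\tilde M_{a|x}$ such that $$p_m\le\epsilon,\qquad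 \tilde M_{a|x}\ge 0\ \ \text{for all } a,x,\qquad \sum_a\tilde M_{a|x}=\begin{pmatrix}\operatorname{diag}(p_0,\dots,p_{m-1})&0\\0&\gamma\end{pmatrix}\ \ \text{for all } x,$$ $$P(a|x,t_j)=\langle\tilde\psi_j|\tilde M_{a|x}|\tilde\psi_j\rangle\quad\text{for all } a,x,j.$$ (2) $G(E',\vec t)=G(-\infty,\vec t)$ for every $E'\in\mathbb{R}$. -/

import Mathlib

open scoped InnerProductSpace Matrix ComplexOrder

noncomputable section

/-- A projection-valued measure on the Borel sets of `ℝ`, acting on a complex Hilbert space;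
countable additivity is meant in the strong operator topology. -/
structure ProjValuedMeasure (𝓗 : Type) [NormedAddCommGroup 𝓗] [InnerProductSpace ℂ 𝓗]
    [CompleteSpace 𝓗] where
  /-- the projection attached to a (Borel) set -/
  proj : Set ℝ → (𝓗 →L[ℂ] 𝓗)
  isStarProjection : ∀ B, MeasurableSet B → IsStarProjection (proj B)
  proj_univ : proj Set.univ = 1
  proj_inter : ∀ B C, MeasurableSet B → MeasurableSet C → proj (B ∩ C) = proj B * proj C
  hasSum_iUnion : ∀ f : ℕ → Set ℝ, (∀ n, MeasurableSet (f n)) →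
    Pairwise (Function.onFun Disjoint f) →
    ∀ ψ : 𝓗, HasSum (fun n => proj (f n) ψ) (proj (⋃ n, f n) ψ)

namespace ProjValuedMeasure

variable {𝓗 : Type} [NormedAddCommGroup 𝓗] [InnerProductSpace ℂ 𝓗] [CompleteSpace 𝓗]

theorem proj_empty (Q : ProjValuedMeasure 𝓗) : Q.proj ∅ = 0 := by
  ext ψ
  have h := Q.hasSum_iUnion (fun _ => ∅) (fun _ => MeasurableSet.empty)
    (fun i j _ => by simp [Function.onFun]) ψ
  simpa using tendsto_const_nhds_iff.mp h.summable.tendsto_atTop_zero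

theorem re_inner_proj_nonneg (Q : ProjValuedMeasure 𝓗) (ψ : 𝓗) {B : Set ℝ}
    (hB : MeasurableSet B) : 0 ≤ (⟪ψ, Q.proj B ψ⟫_ℂ).re := by
  have h := Q.isStarProjection B hB
  have h1 : Q.proj B ψ = Q.proj B (Q.proj B ψ) := by
    conv_lhs => rw [← h.isIdempotentElem.eq]
    rfl
  have h2 : ContinuousLinearMap.adjoint (Q.proj B) = Q.proj B := h.isSelfAdjoint
  rw [h1]
  nth_rewrite 1 [← h2]
  rw [ContinuousLinearMap.adjoint_inner_right]
  exact inner_self_nonneg (𝕜 := ℂ)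

/-- The scalar spectral measure `B ↦ ⟨ψ, Q(B) ψ⟩` of a vector. -/
def scalarMeasure (Q : ProjValuedMeasure 𝓗) (ψ : 𝓗) : MeasureTheory.Measure ℝ :=
  MeasureTheory.Measure.ofMeasurable
    (fun B _ => ENNReal.ofReal (⟪ψ, Q.proj B ψ⟫_ℂ).re)
    (by simp [Q.proj_empty])
    (by
      intro f hf hd
      have h1 := (Q.hasSum_iUnion f hf hd ψ).mapL (innerSL ℂ ψ)
      have h2 := h1.mapL Complex.reCLM
      have h3 : HasSum (fun n => (⟪ψ, Q.proj (f n) ψ⟫_ℂ).re)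
          (⟪ψ, Q.proj (⋃ n, f n) ψ⟫_ℂ).re := by simpa using h2
      rw [← h3.tsum_eq]
      exact ENNReal.ofReal_tsum_of_nonneg
        (fun n => Q.re_inner_proj_nonneg ψ (hf n)) h3.summable)

/-- `T` is the bounded operator `∫ f dQ`. By polarization the quadratic form determines `T`. -/
def IsIntegral (Q : ProjValuedMeasure 𝓗) (f : ℝ → ℂ) (T : 𝓗 →L[ℂ] 𝓗) : Prop :=
  ∀ ψ : 𝓗, ⟪ψ, T ψ⟫_ℂ = ∫ E, f E ∂(Q.scalarMeasure ψ)

/-- `Q` is the spectral measure of the possibly unbounded operator `H`, that is `H = ∫ E dQ(E)`,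
with domain the vectors whose scalar spectral measure has a finite second moment. -/
def IsSpectralMeasureOf (Q : ProjValuedMeasure 𝓗) (H : 𝓗 →ₗ.[ℂ] 𝓗) : Prop :=
  (∀ ψ : 𝓗, ψ ∈ H.domain ↔
      MeasureTheory.Integrable (fun E : ℝ => E ^ 2) (Q.scalarMeasure ψ)) ∧
    ∀ ψ : H.domain, ⟪(ψ : 𝓗), H ψ⟫_ℂ = ((∫ E, E ∂(Q.scalarMeasure (ψ : 𝓗)) : ℝ) : ℂ)

end ProjValuedMeasure

section Operators

variable {𝓗 : Type} [NormedAddCommGroup 𝓗] [InnerProductSpace ℂ 𝓗] [CompleteSpace 𝓗]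

/-- `c` is in the resolvent set of `H`: the operator `H - c` has a bounded two-sided inverse. -/
def InResolventSet (H : 𝓗 →ₗ.[ℂ] 𝓗) (c : ℂ) : Prop :=
  ∃ R : 𝓗 →L[ℂ] 𝓗,
    (∀ y : 𝓗, ∃ h : R y ∈ H.domain, H ⟨R y, h⟩ - c • R y = y) ∧
    ∀ x : H.domain, R (H x - c • (x : 𝓗)) = x

/-- The real spectrum (which is the whole spectrum when `H` is self-adjoint). -/
def realSpectrum (H : 𝓗 →ₗ.[ℂ] 𝓗) : Set ℝ := {E | ¬ InResolventSet H (E : ℂ)}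

/-- `T` is trace class with trace `z`: the diagonal sums converge to `z` in every Hilbert basis. -/
def HasTrace (T : 𝓗 →L[ℂ] 𝓗) (z : ℂ) : Prop :=
  ∀ (ι : Type) (b : HilbertBasis ι ℂ 𝓗), HasSum (fun i => ⟪b i, T (b i)⟫_ℂ) z

end Operators

/-- A quantum realization `(𝓗, ρ, H, M)` with `A` outcomes and `X` measurement settings. The
Hamiltonian `H ≥ 0` is a possibly unbounded self-adjoint operator; it is accompanied by its
spectral measure and its evolution operators `U t = exp (-i H t)`, both determined by `H`. -/
structure Realization (A X : ℕ) where
  𝓗 : Type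
  [normedAddCommGroup : NormedAddCommGroup 𝓗]
  [innerProductSpace : InnerProductSpace ℂ 𝓗]
  [completeSpace : CompleteSpace 𝓗]
  /-- the initial state, a density operator -/
  ρ : 𝓗 →L[ℂ] 𝓗
  ρ_pos : ρ.IsPositive
  ρ_trace : HasTrace ρ 1
  /-- the Hamiltonian -/
  H : 𝓗 →ₗ.[ℂ] 𝓗
  H_selfAdjoint : IsSelfAdjoint H
  H_nonneg : ∀ ψ : H.domain, 0 ≤ (⟪(ψ : 𝓗), H ψ⟫_ℂ).re
  /-- the spectral measure of the Hamiltonian -/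
  Q : ProjValuedMeasure 𝓗
  Q_spec : Q.IsSpectralMeasureOf H
  /-- the evolution operators -/
  U : ℝ → (𝓗 →L[ℂ] 𝓗)
  U_spec : ∀ t : ℝ, Q.IsIntegral (fun E => Complex.exp (-Complex.I * E * t)) (U t)
  /-- the measurements: `M a x` is the effect of outcome `a` in setting `x` -/
  M : Fin A → Fin X → (𝓗 →L[ℂ] 𝓗)
  M_pos : ∀ a x, (M a x).IsPositive
  M_sum : ∀ x, ∑ a, M a x = 1

attribute [instance] Realization.normedAddCommGroup Realization.innerProductSpace
  Realization.completeSpace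

/-- The realization yields `P(a|x,t) = p`, that is `tr (e^{-iHt} ρ e^{iHt} M_{a|x}) = p`. -/
def Realization.Yields {A X : ℕ} (R : Realization A X) (a : Fin A) (x : Fin X) (t p : ℝ) : Prop :=
  HasTrace (R.U t * R.ρ * R.U (-t) * R.M a x) (p : ℂ)

/-- The energy distribution of the state gives weight at most `ε` to the Borel set `B`. -/
def Realization.EnergyWeightLE {A X : ℕ} (R : Realization A X) (B : Set ℝ) (ε : ℝ) : Prop :=
  ∃ w : ℝ, HasTrace (R.ρ * R.Q.proj B) (w : ℂ) ∧ w ≤ ε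

/-- A dataset: for each setting and each time index, a probability distribution over outcomes. -/
def IsDataset {A X N : ℕ} (P : Fin A → Fin X → Fin N → ℝ) : Prop :=
  (∀ a x j, 0 ≤ P a x j) ∧ ∀ x j, ∑ a, P a x j = 1

/-- The set `S(E; Eplus, ε, t)` of datasets, with `P a x j` standing for `P(a|x,t_j)`. -/
def softSpectralDatasets (A X : ℕ) {N m : ℕ} (E : Fin m → ℝ) (Eplus ε : ℝ) (t : Fin N → ℝ) :
    Set (Fin A → Fin X → Fin N → ℝ) :=
  {P | ∃ R : Realization A X,
    realSpectrum R.H ∩ Set.Ico 0 Eplus = Set.range E ∧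
    R.EnergyWeightLE (Set.Ici Eplus) ε ∧
    ∀ a x j, R.Yields a x (t j) (P a x j)}

/-- The closure of the cone of matrices `γ_{jk} = ∫_I exp (-i E (t_k - t_j)) dμ(E)`, where `μ` is a
finite positive Borel measure. -/
def decayMatricesOn {N : ℕ} (I : Set ℝ) (t : Fin N → ℝ) : Set (Matrix (Fin N) (Fin N) ℂ) :=
  closure {γ | ∃ μ : MeasureTheory.Measure ℝ, MeasureTheory.IsFiniteMeasure μ ∧
    ∀ j k, γ j k = ∫ E in I, Complex.exp (-Complex.I * E * (t k - t j)) ∂μ}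

/-- The set `G(t)` of decay matrices. -/
def decayMatrices {N : ℕ} (t : Fin N → ℝ) : Set (Matrix (Fin N) (Fin N) ℂ) :=
  decayMatricesOn Set.univ t

/-- The vector `∑_k exp (-i E_k t_j) |k⟩ + |m + j⟩` of `ℂ^m ⊕ ℂ^N`. -/
def probeVector {N m : ℕ} (E : Fin m → ℝ) (t : Fin N → ℝ) (j : Fin N) : Fin m ⊕ Fin N → ℂ :=
  Sum.elim (fun k => Complex.exp (-Complex.I * E k * t j)) (Pi.single j 1)

end

/-! Necessity. Let `τ(T) = tr(ρ T)`, written through `ρ = σ * σ` as a sum of diagonal elements in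
the vectors `σ bᵢ`. Below `Eplus` the spectral measure `Q` of `H` is carried by the points `E k`, so
the projections onto these levels and `Q [Eplus, ∞)` sum to `1`. Put `V_k = Q {E k}` (each distinct
level used once) and `V_{m+j} = U (t j) Q [Eplus, ∞)`. Weighted by the probe vector, the family `V`
resums to `U (t j)`. Hence the compressions `τ(V_u* M V_w)` of the effects are positive, reproduce
the data, and sum over outcomes to the Gram matrix `τ(V_u* V_w)`. That matrix is block diagonal, and
its high block `τ(U (t k - t j) Q [Eplus, ∞))` is a decay matrix
(`softSpectralDatasets_subset_image`). Certificates normalized by `γ j j = p m` form a compact set,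
so the datasets they describe form a closed set, which absorbs the closure.

Sufficiency. Finitely many phases return close to `1` at arbitrarily large energies, so a point mass
can be moved above any threshold with little change of its decay matrix. This is part (2), and it
makes `γ` a limit of finite combinations of point masses above `max Eplus 0`. For such a combination
the block matrix is `Wᴴ * W`, where `W` sends the probe vectors to the evolved states of a pure
state under a diagonal Hamiltonian. A positive decomposition of `Wᴴ * W` is pulled back from a POVM
(`exists_povm_of_sum_eq`), which gives a realization. Continuity of the matrix square root carries
the decomposition for `γ` over to its approximants (`mem_closure_of_certificate`). -/

noncomputable section

/-! ### Decay matrices as a closed cone, and recurrence of phases. -/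

section DecayCone

open MeasureTheory Filter Topology

open scoped NNReal

variable {N : ℕ}

/-- The decay matrix of a point mass at energy `e`. -/
def phaseMatrix (t : Fin N → ℝ) (e : ℝ) : Fin N → Fin N → ℂ :=
  fun j k => Complex.exp (-Complex.I * e * (t k - t j))

/-- The cone of decay matrices of finitely supported measures on `I`. -/
def phaseCone (I : Set ℝ) (t : Fin N → ℝ) : PointedCone ℝ (Fin N → Fin N → ℂ) :=
  PointedCone.hull ℝ (phaseMatrix t '' I)

theorem norm_exp_phase (e s : ℝ) : ‖Complex.exp (-Complex.I * e * s)‖ = 1 := by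
  rw [show -Complex.I * e * s = ((-(e * s) : ℝ) : ℂ) * Complex.I by push_cast; ring]
  exact Complex.norm_exp_ofReal_mul_I _

theorem norm_phaseMatrix_apply (t : Fin N → ℝ) (e : ℝ) (j k : Fin N) :
    ‖phaseMatrix t e j k‖ = 1 := by
  have := norm_exp_phase e (t k - t j)
  simpa [phaseMatrix] using this

theorem phaseMatrix_diag (t : Fin N → ℝ) (e : ℝ) (j : Fin N) : phaseMatrix t e j j = 1 := by
  simp [phaseMatrix]

theorem continuous_phaseMatrix (t : Fin N → ℝ) : Continuous (phaseMatrix t) := by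
  refine continuous_pi fun j => continuous_pi fun k => ?_
  simp only [phaseMatrix]
  fun_prop

theorem integrable_phaseMatrix (t : Fin N → ℝ) (μ : Measure ℝ) [IsFiniteMeasure μ] :
    Integrable (phaseMatrix t) μ := by
  refine Integrable.of_bound (continuous_phaseMatrix t).aestronglyMeasurable 1
    (Eventually.of_forall fun e => ?_)
  simp only [pi_norm_le_iff_of_nonneg zero_le_one]
  exact fun j k => (norm_phaseMatrix_apply t e j k).le

theorem integral_phaseMatrix_apply (t : Fin N → ℝ) (μ : Measure ℝ) [IsFiniteMeasure μ]
    (j k : Fin N) : (∫ e, phaseMatrix t e ∂μ) j k = ∫ e, phaseMatrix t e j k ∂μ := by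
  let L : (Fin N → Fin N → ℂ) →L[ℝ] ℂ :=
    (ContinuousLinearMap.proj (R := ℝ) (φ := fun _ : Fin N => ℂ) k).comp
      (ContinuousLinearMap.proj (R := ℝ) (φ := fun _ : Fin N => Fin N → ℂ) j)
  exact (L.integral_comp_comm (integrable_phaseMatrix t μ)).symm

theorem mem_phaseCone {I : Set ℝ} {t : Fin N → ℝ} {γ : Fin N → Fin N → ℂ} :
    γ ∈ phaseCone I t ↔ ∃ (n : ℕ) (c : Fin n → ℝ≥0) (e : Fin n → ℝ), (∀ i, e i ∈ I) ∧
      γ = ∑ i, c i • phaseMatrix t (e i) := by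
  constructor
  · intro hγ
    obtain ⟨n, c, g, rfl⟩ := Submodule.mem_span_set'.1 hγ
    choose e he hg using fun i => (g i).2
    exact ⟨n, c, e, he, Finset.sum_congr rfl fun i _ => by rw [hg]; rfl⟩
  · rintro ⟨n, c, e, he, rfl⟩
    exact sum_mem fun i _ =>
      Submodule.smul_mem _ (c i) (Submodule.subset_span ⟨e i, he i, rfl⟩)

/-- The integral is the total mass times an average, and an average of values in a closed convex set
stays in that set. -/
theorem integral_phaseMatrix_mem_closure {I : Set ℝ} (hI : MeasurableSet I) (t : Fin N → ℝ)
    (μ : Measure ℝ) [IsFiniteMeasure μ] :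
    ∫ e in I, phaseMatrix t e ∂μ ∈ closure (phaseCone I t : Set (Fin N → Fin N → ℂ)) := by
  have hC : ∀ c : ℝ, 0 ≤ c → ∀ x ∈ closure (phaseCone I t : Set (Fin N → Fin N → ℂ)),
      c • x ∈ closure (phaseCone I t : Set (Fin N → Fin N → ℂ)) := by
    intro c hc x hx
    exact (phaseCone I t).topologicalClosure.smul_mem (⟨c, hc⟩ : ℝ≥0) hx
  rcases eq_or_ne (μ.restrict I) 0 with h0 | h0
  · rw [h0, integral_zero_measure]
    exact subset_closure (zero_mem _)
  · have : NeZero (μ.restrict I) := ⟨h0⟩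
    rw [← measure_smul_average]
    refine hC _ measureReal_nonneg _ ?_
    refine Convex.average_mem ?_ isClosed_closure ?_ (integrable_phaseMatrix t (μ.restrict I))
    · exact (phaseCone I t).toConvexCone.convex.closure
    · filter_upwards [ae_restrict_mem hI] with e he
      exact subset_closure (Submodule.subset_span ⟨e, he, rfl⟩)

theorem decayMatricesOn_eq_closure {I : Set ℝ} (hI : MeasurableSet I) (t : Fin N → ℝ) :
    decayMatricesOn I t = closure (phaseCone I t : Set (Fin N → Fin N → ℂ)) := by
  apply Set.Subset.antisymm
  · refine closure_minimal ?_ isClosed_closure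
    rintro γ ⟨μ, hμ, hγ⟩
    have h : γ = ∫ e in I, phaseMatrix t e ∂μ := by
      funext j k
      rw [integral_phaseMatrix_apply]
      exact hγ j k
    rw [h]
    exact integral_phaseMatrix_mem_closure hI t μ
  · refine closure_mono ?_
    intro γ hγ
    obtain ⟨n, c, e, he, rfl⟩ := mem_phaseCone.1 hγ
    have hI' : ∀ i, (Measure.dirac (e i)).restrict I = Measure.dirac (e i) := fun i => by
      classical
      rw [restrict_dirac' hI, if_pos (he i)]
    refine ⟨∑ i, c i • Measure.dirac (e i), ⟨?_⟩, fun j k => ?_⟩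
    · simp only [Measure.coe_finsetSum, Finset.sum_apply]
      exact ENNReal.sum_lt_top.2 fun i _ => measure_lt_top _ _
    · have hsum : (∑ i, c i • Measure.dirac (e i)).restrict I =
          ∑ i, (c i • Measure.dirac (e i)).restrict I :=
        map_sum (Measure.restrictₗ I) (fun i => c i • Measure.dirac (e i)) Finset.univ
      rw [hsum, integral_finsetSum_measure]
      · simp [Measure.restrict_smul, hI', phaseMatrix, NNReal.smul_def]
      · intro i _
        rw [Measure.restrict_smul, hI']
        exact (integrable_dirac (by simp)).smul_measure_nnreal

/-- A finite family of phases recurs arbitrarily late. -/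
theorem exists_large_near_one (t : Fin N → ℝ) {δ : ℝ} (hδ : 0 < δ) (n₀ : ℕ) :
    ∃ n : ℕ, n₀ ≤ n ∧ ∀ j, ‖Complex.exp (-Complex.I * n * t j) - 1‖ < δ := by
  let u : ℕ → Fin N → ℂ := fun n j => Complex.exp (-Complex.I * n * t j)
  have hu1 : ∀ n j, ‖u n j‖ = 1 := fun n j => by
    have := norm_exp_phase (n : ℝ) (t j)
    simpa [u] using this
  have hu : ∀ n, u n ∈ Metric.closedBall (0 : Fin N → ℂ) 1 := fun n => by
    rw [mem_closedBall_zero_iff, pi_norm_le_iff_of_nonneg zero_le_one]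
    exact fun j => (hu1 n j).le
  -- By compactness some subsequence is Cauchy. The quotient of two of its late terms is the phase
  -- vector at the difference of their indices, and it is close to `1`.
  obtain ⟨a, -, φ, hφ, hlim⟩ := (isCompact_closedBall (0 : Fin N → ℂ) 1).tendsto_subseq hu
  obtain ⟨K, hK⟩ := Metric.cauchySeq_iff.1 hlim.cauchySeq δ hδ
  obtain ⟨L, hL, hL'⟩ : ∃ L, K ≤ L ∧ φ K + n₀ ≤ φ L :=
    ((eventually_ge_atTop K).and (hφ.tendsto_atTop.eventually_ge_atTop _)).exists
  refine ⟨φ L - φ K, by omega, fun j => ?_⟩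
  have h := hK L hL K le_rfl
  rw [dist_eq_norm] at h
  have h1 : u (φ L) j = u (φ L - φ K) j * u (φ K) j := by
    simp only [u, ← Complex.exp_add]
    congr 1
    rw [Nat.cast_sub (by omega)]
    ring
  calc ‖u (φ L - φ K) j - 1‖ = ‖(u (φ L - φ K) j - 1) * u (φ K) j‖ := by
        rw [norm_mul, hu1, mul_one]
    _ = ‖(u (φ L) - u (φ K)) j‖ := by rw [Pi.sub_apply, h1, sub_mul, one_mul]
    _ ≤ ‖u (φ L) - u (φ K)‖ := norm_le_pi_norm _ j
    _ < δ := h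

/-- Raising the energy by a recurrence time `n` multiplies each entry by a ratio of two phases close
to `1`. -/
theorem phaseMatrix_mem_closure_image_Ici (t : Fin N → ℝ) (e e' : ℝ) :
    phaseMatrix t e ∈ closure (phaseMatrix t '' Set.Ici e') := by
  rw [Metric.mem_closure_iff]
  intro δ hδ
  obtain ⟨n₀, hn₀⟩ := exists_nat_ge (e' - e)
  -- A quarter of `δ` for each of the two phases leaves an entrywise bound `δ / 2`, so that the sup
  -- norm is strictly below `δ`.
  obtain ⟨n, hn, hn'⟩ := exists_large_near_one t (half_pos (half_pos hδ)) n₀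
  refine ⟨_, ⟨e + n, ?_, rfl⟩, ?_⟩
  · have : (n₀ : ℝ) ≤ n := by exact_mod_cast hn
    simp only [Set.mem_Ici]
    linarith
  have hw : ∀ j, ‖Complex.exp (-Complex.I * n * t j)‖ = 1 := fun j => by
    simpa using norm_exp_phase (n : ℝ) (t j)
  rw [dist_comm, dist_eq_norm]
  refine lt_of_le_of_lt ?_ (half_lt_self hδ)
  rw [pi_norm_le_iff_of_nonneg (by positivity)]
  intro j
  rw [pi_norm_le_iff_of_nonneg (by positivity)]
  intro k
  have h1 : phaseMatrix t (e + n) j k = phaseMatrix t e j k * Complex.exp (-Complex.I * n * t k) /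
      Complex.exp (-Complex.I * n * t j) := by
    simp only [phaseMatrix, ← Complex.exp_add, ← Complex.exp_sub]
    congr 1
    push_cast
    ring
  have h2 : (phaseMatrix t (e + n) - phaseMatrix t e) j k = phaseMatrix t e j k *
      ((Complex.exp (-Complex.I * n * t k) - 1) - (Complex.exp (-Complex.I * n * t j) - 1)) /
      Complex.exp (-Complex.I * n * t j) := by
    rw [Pi.sub_apply, Pi.sub_apply, h1]
    field_simp [Complex.exp_ne_zero]
    ring
  rw [h2, norm_div, norm_mul, norm_phaseMatrix_apply, hw, one_mul, div_one]
  refine (norm_sub_le _ _).trans ?_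
  linarith [hn' k, hn' j]

theorem closure_phaseCone_Ici (t : Fin N → ℝ) (e' : ℝ) :
    closure (phaseCone (Set.Ici e') t : Set (Fin N → Fin N → ℂ)) =
      closure (phaseCone Set.univ t : Set (Fin N → Fin N → ℂ)) := by
  apply Set.Subset.antisymm
  · exact closure_mono (Submodule.span_mono (Set.image_mono (Set.subset_univ _)))
  · refine closure_minimal ?_ isClosed_closure
    have : phaseCone Set.univ t ≤ (phaseCone (Set.Ici e') t).topologicalClosure := by
      refine Submodule.span_le.2 ?_
      rintro _ ⟨e, -, rfl⟩
      exact closure_mono Submodule.subset_span (phaseMatrix_mem_closure_image_Ici t e e')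
    exact this

theorem decayMatricesOn_Ici (t : Fin N → ℝ) (e' : ℝ) :
    decayMatricesOn (Set.Ici e') t = decayMatrices t := by
  rw [decayMatrices, decayMatricesOn_eq_closure measurableSet_Ici,
    decayMatricesOn_eq_closure MeasurableSet.univ]
  exact closure_phaseCone_Ici t e'

/-- All entries of a phase matrix have modulus one and its diagonal is `1`, so the triangle
inequality bounds an entry of a combination by the total weight. The bound is a closed condition. -/
theorem norm_apply_le_of_mem_closure {I : Set ℝ} {t : Fin N → ℝ} {γ : Fin N → Fin N → ℂ}
    (hγ : γ ∈ closure (phaseCone I t : Set (Fin N → Fin N → ℂ))) (j k : Fin N) :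
    ‖γ j k‖ ≤ (γ j j).re := by
  have hcl : IsClosed {γ : Fin N → Fin N → ℂ | ‖γ j k‖ ≤ (γ j j).re} :=
    isClosed_le (by fun_prop) (by fun_prop)
  refine closure_minimal ?_ hcl hγ
  intro γ hγ
  obtain ⟨n, c, e, he, rfl⟩ := mem_phaseCone.1 hγ
  simp only [Set.mem_ofPred_eq, Finset.sum_apply, Pi.smul_apply, phaseMatrix_diag]
  refine (norm_sum_le _ _).trans ?_
  rw [Complex.re_sum]
  refine Finset.sum_le_sum fun i _ => ?_
  rw [NNReal.smul_def, NNReal.smul_def, norm_smul, norm_phaseMatrix_apply]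
  simp

end DecayCone

/-! ### Square roots and entry bounds for positive semidefinite matrices. -/

section MatrixSqrt

open scoped MatrixOrder Matrix.Norms.L2Operator

open Filter Topology

variable {n : Type*} [Fintype n] [DecidableEq n]

theorem Matrix.PosSemidef.exists_eq_conjTranspose_mul_self {M : Matrix n n ℂ} (hM : M.PosSemidef) :
    ∃ B : Matrix n n ℂ, M = Bᴴ * B :=
  CStarAlgebra.nonneg_iff_eq_star_mul_self.1 hM.nonneg

/-- The positive square root of positive semidefinite matrices is continuous. -/
theorem Matrix.exists_continuousOn_sqrt :
    ∃ S : Matrix n n ℂ → Matrix n n ℂ, ContinuousOn S {D | D.PosSemidef} ∧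
      ∀ D : Matrix n n ℂ, D.PosSemidef → (S D)ᴴ * S D = D := by
  refine ⟨CFC.sqrt, ?_, fun D hD => ?_⟩
  · have h : ContinuousOn (CFC.sqrt : Matrix n n ℂ → Matrix n n ℂ) {D | 0 ≤ D} :=
      CFC.continuousOn_sqrt
    simpa only [Matrix.nonneg_iff_posSemidef] using h
  · have h1 : (CFC.sqrt D)ᴴ = CFC.sqrt D :=
      (Matrix.nonneg_iff_posSemidef.1 (CFC.sqrt_nonneg D)).isHermitian
    rw [h1]
    exact CFC.sqrt_mul_sqrt_self D hD.nonneg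

/-- Entries of a Gram matrix are inner products of columns; apply `2ab ≤ a² + b²` termwise. -/
theorem Matrix.PosSemidef.norm_apply_le {M : Matrix n n ℂ} (hM : M.PosSemidef) (i j : n) :
    ‖M i j‖ ≤ ((M i i).re + (M j j).re) / 2 := by
  obtain ⟨B, rfl⟩ := hM.exists_eq_conjTranspose_mul_self
  have hdiag : ∀ k, ((Bᴴ * B) k k).re = ∑ l, ‖B l k‖ ^ 2 := fun k => by
    rw [Matrix.mul_apply, Complex.re_sum]
    refine Finset.sum_congr rfl fun l _ => ?_
    rw [Matrix.conjTranspose_apply, ← Complex.normSq_eq_norm_sq, RCLike.star_def,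
      Complex.normSq_eq_conj_mul_self.symm]
    simp
  rw [hdiag, hdiag, Matrix.mul_apply, ← Finset.sum_add_distrib, Finset.sum_div]
  refine norm_sum_le_of_le _ fun l _ => ?_
  rw [Matrix.conjTranspose_apply, norm_mul, norm_star]
  nlinarith [sq_nonneg (‖B l i‖ - ‖B l j‖)]

end MatrixSqrt

/-! ### Generalized inverses and POVMs induced by decompositions. -/

section PseudoInverse

open Matrix

variable {m n : Type*} [Fintype m] [Fintype n] [DecidableEq n]

/-- A Hermitian matrix has a Hermitian generalized inverse. -/
theorem Matrix.IsHermitian.exists_generalizedInverse {G : Matrix n n ℂ} (hG : G.IsHermitian) :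
    ∃ K : Matrix n n ℂ, K.IsHermitian ∧ G * K * G = G := by
  let V : Matrix n n ℂ := (hG.eigenvectorUnitary : Matrix n n ℂ)
  let d : n → ℂ := fun i => (hG.eigenvalues i : ℂ)
  have hV : star V * V = 1 := Unitary.coe_star_mul_self hG.eigenvectorUnitary
  have hS : G = V * diagonal d * star V := hG.spectral_theorem
  have hd : diagonal d * diagonal (fun i => (d i)⁻¹) * diagonal d = diagonal d := by
    rw [diagonal_mul_diagonal, diagonal_mul_diagonal]
    congr 1
    funext i
    -- Zero eigenvalues are covered by the convention `0⁻¹ = 0`.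
    exact mul_inv_mul_cancel _
  refine ⟨V * diagonal (fun i => (d i)⁻¹) * star V, ?_, ?_⟩
  · rw [IsHermitian, conjTranspose_mul, conjTranspose_mul, star_eq_conjTranspose,
      conjTranspose_conjTranspose, diagonal_conjTranspose, Matrix.mul_assoc]
    congr 3
    funext i
    simp [d]
  · conv_lhs => rw [hS]
    calc V * diagonal d * star V * (V * diagonal (fun i => (d i)⁻¹) * star V) *
          (V * diagonal d * star V)
        = V * diagonal d * (star V * V) * diagonal (fun i => (d i)⁻¹) * (star V * V) *
          diagonal d * star V := by simp only [Matrix.mul_assoc]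
      _ = V * (diagonal d * diagonal (fun i => (d i)⁻¹) * diagonal d) * star V := by
          rw [hV]; simp only [Matrix.mul_assoc, Matrix.mul_one]
      _ = G := by rw [hd, ← hS]

/-- A matrix `W` has a generalized inverse `K` such that `W * K` is an orthogonal projection. -/
theorem Matrix.exists_generalizedInverse (W : Matrix m n ℂ) :
    ∃ K : Matrix n m ℂ, (W * K).IsHermitian ∧ W * K * W = W := by
  obtain ⟨G, hG, hG'⟩ := (isHermitian_conjTranspose_mul_self W).exists_generalizedInverse
  refine ⟨G * Wᴴ, ?_, ?_⟩
  · rw [IsHermitian, conjTranspose_mul, conjTranspose_mul, conjTranspose_conjTranspose, hG.eq,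
      Matrix.mul_assoc]
  · rw [← sub_eq_zero]
    have h : W * (G * Wᴴ) * W - W = W * (G * (Wᴴ * W) - 1) := by
      rw [Matrix.mul_sub, Matrix.mul_one]
      simp only [Matrix.mul_assoc]
    -- `Wᴴ * W` and `W` have the same kernel, so the identity may be checked after multiplying by
    -- `Wᴴ`.
    rw [h, ← conjTranspose_mul_self_mul_eq_zero, Matrix.mul_sub, Matrix.mul_one,
      ← Matrix.mul_assoc, hG', sub_self]

/-- A decomposition of `Wᴴ * W` into positive semidefinite matrices is induced by a POVM. -/
theorem exists_povm_of_sum_eq [DecidableEq m] {A : ℕ} (hA : 0 < A) (W : Matrix m n ℂ)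
    (M : Fin A → Matrix n n ℂ) (hM : ∀ a, (M a).PosSemidef) (hsum : ∑ a, M a = Wᴴ * W) :
    ∃ F : Fin A → Matrix m m ℂ, (∀ a, (F a).PosSemidef) ∧ ∑ a, F a = 1 ∧
      ∀ a, Wᴴ * F a * W = M a := by
  obtain ⟨K, hK, hW⟩ := W.exists_generalizedInverse
  have hWK : W * (K * W - 1) = 0 := by
    rw [Matrix.mul_sub, ← Matrix.mul_assoc, hW, Matrix.mul_one, sub_self]
  -- Each `M a` kills the kernel of `W`: the traces of the compressions of the `M a` to the range of
  -- `K * W - 1` are nonnegative and sum to zero.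
  have hker : ∀ a, M a * (K * W) = M a := by
    choose B hB using fun a => (hM a).exists_eq_conjTranspose_mul_self
    have htot : ∑ a, ((B a * (K * W - 1))ᴴ * (B a * (K * W - 1))).trace = 0 := by
      rw [← trace_sum]
      have : ∀ a, (B a * (K * W - 1))ᴴ * (B a * (K * W - 1)) =
          (K * W - 1)ᴴ * M a * (K * W - 1) := fun a => by
        rw [hB, conjTranspose_mul]
        simp only [Matrix.mul_assoc]
      simp only [this]
      rw [← Matrix.sum_mul, ← Matrix.mul_sum, hsum]
      simp only [Matrix.mul_assoc]
      rw [hWK]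
      simp
    intro a
    have h0 := (Finset.sum_eq_zero_iff_of_nonneg fun b _ =>
      (posSemidef_conjTranspose_mul_self (B b * (K * W - 1))).trace_nonneg).1 htot a
        (Finset.mem_univ a)
    have h1 := trace_conjTranspose_mul_self_eq_zero_iff.1 h0
    have h2 : M a * (K * W - 1) = 0 := by rw [hB, Matrix.mul_assoc, h1, Matrix.mul_zero]
    rwa [Matrix.mul_sub, Matrix.mul_one, sub_eq_zero] at h2
  have hKid : W * K * (W * K) = W * K := by rw [← Matrix.mul_assoc, hW]
  have hcompl : (1 - W * K).PosSemidef := by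
    have h : 1 - W * K = (1 - W * K)ᴴ * (1 - W * K) := by
      rw [conjTranspose_sub, conjTranspose_one, hK.eq, Matrix.mul_sub, Matrix.sub_mul,
        Matrix.sub_mul, hKid]
      simp
    rw [h]
    exact posSemidef_conjTranspose_mul_self _
  have hKW : Kᴴ * Wᴴ = W * K := by rw [← conjTranspose_mul, hK.eq]
  -- The conjugates `Kᴴ * M a * K` only sum to the projection `W * K`. Its complement, invisible to
  -- `W`, is given to outcome `0`, which exists as `0 < A`.
  refine ⟨fun a => Kᴴ * M a * K + if a = ⟨0, hA⟩ then 1 - W * K else 0, ?_, ?_, ?_⟩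
  · intro a
    refine ((hM a).conjTranspose_mul_mul_same K).add ?_
    split_ifs
    · exact hcompl
    · exact PosSemidef.zero
  · rw [Finset.sum_add_distrib, ← Matrix.sum_mul, ← Matrix.mul_sum, hsum]
    simp only [Finset.sum_ite_eq', Finset.mem_univ, if_true]
    rw [← Matrix.mul_assoc, hKW, Matrix.mul_assoc, hKid]
    simp
  · intro a
    have h1 : Wᴴ * (Kᴴ * M a * K) * W = M a := by
      have : (K * W)ᴴ * M a = M a := by
        have := congrArg conjTranspose (hker a)
        rwa [conjTranspose_mul, (hM a).isHermitian.eq] at this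
      calc Wᴴ * (Kᴴ * M a * K) * W = (K * W)ᴴ * M a * (K * W) := by
            rw [conjTranspose_mul]; simp only [Matrix.mul_assoc]
        _ = M a := by rw [this, hker]
    have h2 : (1 - W * K) * W = 0 := by rw [Matrix.sub_mul, hW]; simp
    rw [Matrix.mul_add, Matrix.add_mul, h1]
    split_ifs
    · rw [Matrix.mul_assoc, h2]; simp
    · simp

end PseudoInverse

/-! ### Bounded functional calculus of a projection-valued measure. -/

theorem inner_apply_polarization {𝓗 : Type*} [NormedAddCommGroup 𝓗] [InnerProductSpace ℂ 𝓗]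
    (T : 𝓗 →L[ℂ] 𝓗) (φ ψ : 𝓗) :
    ⟪φ, T ψ⟫_ℂ = (⟪φ + ψ, T (φ + ψ)⟫_ℂ - ⟪φ - ψ, T (φ - ψ)⟫_ℂ
      - Complex.I * ⟪φ + Complex.I • ψ, T (φ + Complex.I • ψ)⟫_ℂ
      + Complex.I * ⟪φ - Complex.I • ψ, T (φ - Complex.I • ψ)⟫_ℂ) / 4 := by
  simp only [map_add, map_sub, map_smul, inner_add_left, inner_add_right, inner_sub_left,
    inner_sub_right, inner_smul_left, inner_smul_right, Complex.conj_I]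
  linear_combination (⟪φ, T ψ⟫_ℂ / 2 - ⟪ψ, T φ⟫_ℂ / 2) * Complex.I_mul_I

namespace ProjValuedMeasure

open MeasureTheory Filter Topology

variable {𝓗 : Type} [NormedAddCommGroup 𝓗] [InnerProductSpace ℂ 𝓗] [CompleteSpace 𝓗]
variable (Q : ProjValuedMeasure 𝓗)

theorem inner_proj_left {B : Set ℝ} (hB : MeasurableSet B) (φ ψ : 𝓗) :
    ⟪Q.proj B φ, ψ⟫_ℂ = ⟪φ, Q.proj B ψ⟫_ℂ := by
  have h : ContinuousLinearMap.adjoint (Q.proj B) = Q.proj B :=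
    (Q.isStarProjection B hB).isSelfAdjoint
  nth_rewrite 1 [← h]
  exact ContinuousLinearMap.adjoint_inner_left _ _ _

theorem proj_proj {B C : Set ℝ} (hB : MeasurableSet B) (hC : MeasurableSet C) (ψ : 𝓗) :
    Q.proj B (Q.proj C ψ) = Q.proj (B ∩ C) ψ := by
  rw [Q.proj_inter B C hB hC]
  rfl

theorem inner_proj_self {B : Set ℝ} (hB : MeasurableSet B) (ψ : 𝓗) :
    ⟪ψ, Q.proj B ψ⟫_ℂ = ((‖Q.proj B ψ‖ ^ 2 : ℝ) : ℂ) := by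
  have h : Q.proj B ψ = Q.proj B (Q.proj B ψ) := by rw [Q.proj_proj hB hB, Set.inter_self]
  rw [h, ← Q.inner_proj_left hB, ← h, inner_self_eq_norm_sq_to_K]
  simp

theorem scalarMeasure_apply {B : Set ℝ} (hB : MeasurableSet B) (ψ : 𝓗) :
    Q.scalarMeasure ψ B = ENNReal.ofReal (‖Q.proj B ψ‖ ^ 2) := by
  rw [scalarMeasure, Measure.ofMeasurable_apply _ hB, Q.inner_proj_self hB, Complex.ofReal_re]

theorem scalarMeasure_real {B : Set ℝ} (hB : MeasurableSet B) (ψ : 𝓗) :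
    (Q.scalarMeasure ψ).real B = ‖Q.proj B ψ‖ ^ 2 := by
  rw [Measure.real, Q.scalarMeasure_apply hB, ENNReal.toReal_ofReal (by positivity)]

instance isFiniteMeasure_scalarMeasure (ψ : 𝓗) : IsFiniteMeasure (Q.scalarMeasure ψ) :=
  ⟨by rw [Q.scalarMeasure_apply MeasurableSet.univ]; exact ENNReal.ofReal_lt_top⟩

theorem scalarMeasure_real_univ (ψ : 𝓗) : (Q.scalarMeasure ψ).real Set.univ = ‖ψ‖ ^ 2 := by
  rw [Q.scalarMeasure_real MeasurableSet.univ, Q.proj_univ]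
  rfl

variable {Q}

theorem IsIntegral.ext {f : ℝ → ℂ} {S T : 𝓗 →L[ℂ] 𝓗} (hS : Q.IsIntegral f S)
    (hT : Q.IsIntegral f T) : S = T := by
  have h : (S : 𝓗 →ₗ[ℂ] 𝓗) = T := by
    rw [← ext_inner_map]
    intro ψ
    have h := (hS ψ).trans (hT ψ).symm
    have := congrArg (starRingEnd ℂ) h
    rwa [inner_conj_symm, inner_conj_symm] at this
  exact ContinuousLinearMap.coe_injective h

variable (Q) in
theorem isIntegral_indicator {B : Set ℝ} (hB : MeasurableSet B) :
    Q.IsIntegral (B.indicator 1) (Q.proj B) := by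
  intro ψ
  rw [Q.inner_proj_self hB, integral_indicator hB, ← Q.scalarMeasure_real hB]
  simp

/-- Boundedness and measurability. -/
def IsBddMeasurable (f : ℝ → ℂ) : Prop := Measurable f ∧ ∃ C, ∀ x, ‖f x‖ ≤ C

theorem IsBddMeasurable.integrable {f : ℝ → ℂ} (hf : IsBddMeasurable f) (μ : Measure ℝ)
    [IsFiniteMeasure μ] : Integrable f μ := by
  obtain ⟨h, C, hC⟩ := hf
  exact Integrable.of_bound h.aestronglyMeasurable C (Eventually.of_forall hC)

theorem isBddMeasurable_indicator {B : Set ℝ} (hB : MeasurableSet B) :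
    IsBddMeasurable (B.indicator 1) := by
  refine ⟨measurable_one.indicator hB, 1, fun x => ?_⟩
  by_cases h : x ∈ B <;> simp [h]

theorem IsBddMeasurable.mul {f g : ℝ → ℂ} (hf : IsBddMeasurable f) (hg : IsBddMeasurable g) :
    IsBddMeasurable (f * g) := by
  obtain ⟨hf, C, hC⟩ := hf
  obtain ⟨hg, D, hD⟩ := hg
  refine ⟨hf.mul hg, C * D, fun x => ?_⟩
  rw [Pi.mul_apply, norm_mul]
  exact mul_le_mul (hC x) (hD x) (norm_nonneg _) ((norm_nonneg _).trans (hC x))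

theorem isBddMeasurable_simpleFunc (s : SimpleFunc ℝ ℂ) : IsBddMeasurable s :=
  ⟨s.measurable, s.exists_forall_norm_le⟩

theorem isBddMeasurable_phase (s : ℝ) :
    IsBddMeasurable (fun e : ℝ => Complex.exp (-Complex.I * e * s)) :=
  ⟨by fun_prop, 1, fun e => (norm_exp_phase e s).le⟩

theorem IsIntegral.add {f g : ℝ → ℂ} {S T : 𝓗 →L[ℂ] 𝓗} (hf : IsBddMeasurable f)
    (hg : IsBddMeasurable g) (hS : Q.IsIntegral f S) (hT : Q.IsIntegral g T) :
    Q.IsIntegral (f + g) (S + T) := by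
  intro ψ
  rw [add_apply, inner_add_right, hS, hT]
  exact (integral_add (hf.integrable _) (hg.integrable _)).symm

theorem IsIntegral.smul {f : ℝ → ℂ} {S : 𝓗 →L[ℂ] 𝓗} (hS : Q.IsIntegral f S) (c : ℂ) :
    Q.IsIntegral (c • f) (c • S) := by
  intro ψ
  rw [smul_apply, inner_smul_right, hS]
  exact (integral_smul c _).symm

theorem IsIntegral.adjoint {f : ℝ → ℂ} {S : 𝓗 →L[ℂ] 𝓗} (hS : Q.IsIntegral f S) :
    Q.IsIntegral (fun x => starRingEnd ℂ (f x)) (ContinuousLinearMap.adjoint S) := by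
  intro ψ
  rw [ContinuousLinearMap.adjoint_inner_right, ← inner_conj_symm, hS, integral_conj]

/-- Bounded pointwise convergence of functions gives weak convergence of their integrals. -/
theorem IsIntegral.tendsto_inner {f : ℕ → ℝ → ℂ} {g : ℝ → ℂ} {T : ℕ → 𝓗 →L[ℂ] 𝓗}
    {S : 𝓗 →L[ℂ] 𝓗} {C : ℝ} (hf : ∀ n, Measurable (f n)) (hC : ∀ n x, ‖f n x‖ ≤ C)
    (hlim : ∀ x, Tendsto (fun n => f n x) atTop (𝓝 (g x))) (hT : ∀ n, Q.IsIntegral (f n) (T n))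
    (hS : Q.IsIntegral g S) (φ ψ : 𝓗) :
    Tendsto (fun n => ⟪φ, T n ψ⟫_ℂ) atTop (𝓝 ⟪φ, S ψ⟫_ℂ) := by
  have hq : ∀ χ : 𝓗, Tendsto (fun n => ⟪χ, T n χ⟫_ℂ) atTop (𝓝 ⟪χ, S χ⟫_ℂ) := by
    intro χ
    simp only [hT _ χ, hS χ]
    exact tendsto_integral_of_dominated_convergence (fun _ => C)
      (fun n => (hf n).aestronglyMeasurable) (integrable_const _)
      (fun n => Eventually.of_forall (hC n)) (Eventually.of_forall hlim)
  simp only [inner_apply_polarization _ φ ψ]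
  exact (((((hq _).sub (hq _)).sub ((hq _).const_mul _)).add ((hq _).const_mul _)).div_const _)

theorem IsBddMeasurable.exists_simpleFunc {f : ℝ → ℂ} (hf : IsBddMeasurable f) :
    ∃ (s : ℕ → SimpleFunc ℝ ℂ) (C : ℝ), (∀ n x, ‖s n x‖ ≤ C) ∧
      ∀ x, Tendsto (fun n => s n x) atTop (𝓝 (f x)) := by
  obtain ⟨hf, C, hC⟩ := hf
  have hC0 : 0 ≤ C := (norm_nonneg _).trans (hC 0)
  have hs := hf.stronglyMeasurable
  exact ⟨hs.approxBounded C, C, fun n x => hs.norm_approxBounded_le hC0 n x,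
    fun x => hs.tendsto_approxBounded_of_norm_le (hC x)⟩

/-- The predicate `p` is left free so that one induction produces an operator together with the
product identity wanted for it. -/
theorem exists_isIntegral_simpleFunc (s : SimpleFunc ℝ ℂ) {p : (ℝ → ℂ) → (𝓗 →L[ℂ] 𝓗) → Prop}
    (hind : ∀ B, MeasurableSet B → p (B.indicator 1) (Q.proj B))
    (hsmul : ∀ (c : ℂ) f T, p f T → p (c • f) (c • T))
    (hadd : ∀ f g S T, IsBddMeasurable f → IsBddMeasurable g → p f S → p g T →
      p (f + g) (S + T)) : ∃ T, p s T := by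
  induction s using SimpleFunc.induction with
  | const c hB =>
    rename_i B
    refine ⟨c • Q.proj B, ?_⟩
    convert hsmul c _ _ (hind B hB) using 1
    ext x
    by_cases h : x ∈ B <;> simp [h]
  | add hd hf hg =>
    rename_i f g
    obtain ⟨S, hS⟩ := hf
    obtain ⟨T, hT⟩ := hg
    exact ⟨S + T, hadd _ _ _ _ (isBddMeasurable_simpleFunc f) (isBddMeasurable_simpleFunc g) hS hT⟩

/-- For indicators this is `proj_inter`. Linearity gives simple functions, and bounded pointwise
limits give the rest: the matrix elements converge weakly on one side and by dominated convergence
on the other. -/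
theorem IsIntegral.mul_proj {f : ℝ → ℂ} {T : 𝓗 →L[ℂ] 𝓗} (hf : IsBddMeasurable f)
    (hT : Q.IsIntegral f T) {C : Set ℝ} (hC : MeasurableSet C) :
    Q.IsIntegral (f * C.indicator 1) (T * Q.proj C) := by
  obtain ⟨s, K, hK, hlim⟩ := hf.exists_simpleFunc
  have hex : ∀ n, ∃ S, Q.IsIntegral (s n) S ∧
      Q.IsIntegral (⇑(s n) * C.indicator 1) (S * Q.proj C) := by
    intro n
    refine exists_isIntegral_simpleFunc (Q := Q) (s n)
      (p := fun f S => Q.IsIntegral f S ∧ Q.IsIntegral (f * C.indicator 1) (S * Q.proj C))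
      (fun B hB => ⟨Q.isIntegral_indicator hB, ?_⟩) (fun c f S h => ⟨h.1.smul c, ?_⟩)
      (fun f g S T hf hg hS hT => ⟨hS.1.add hf hg hT.1, ?_⟩)
    · rw [← Q.proj_inter B C hB hC, ← Set.inter_indicator_one]
      exact Q.isIntegral_indicator (hB.inter hC)
    · rw [smul_mul_assoc, smul_mul_assoc]
      exact h.2.smul c
    · rw [add_mul, add_mul]
      exact hS.2.add (hf.mul (isBddMeasurable_indicator hC))
        (hg.mul (isBddMeasurable_indicator hC)) hT.2
  choose S hS hS' using hex
  intro ψ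
  have h1 := IsIntegral.tendsto_inner (fun n => (s n).measurable) hK hlim hS hT ψ (Q.proj C ψ)
  have h2 : ∀ n, ⟪ψ, S n (Q.proj C ψ)⟫_ℂ =
      ∫ e, (⇑(s n) * C.indicator 1 : ℝ → ℂ) e ∂(Q.scalarMeasure ψ) := fun n => hS' n ψ
  simp only [h2] at h1
  refine tendsto_nhds_unique h1 ?_
  refine tendsto_integral_of_dominated_convergence (fun _ => K)
      (fun n => ((s n).measurable.mul (isBddMeasurable_indicator hC).1).aestronglyMeasurable)
      (integrable_const _) (fun n => Eventually.of_forall fun x => ?_)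
      (Eventually.of_forall fun x => (hlim x).mul_const _)
  by_cases h : x ∈ C
  · simpa [h] using hK n x
  · simpa [h] using (norm_nonneg _).trans (hK n x)

/-- Integrals with respect to a projection-valued measure are multiplicative. -/
theorem IsIntegral.mul {f g : ℝ → ℂ} {S T : 𝓗 →L[ℂ] 𝓗} (hf : IsBddMeasurable f)
    (hg : IsBddMeasurable g) (hS : Q.IsIntegral f S) (hT : Q.IsIntegral g T) :
    Q.IsIntegral (f * g) (S * T) := by
  obtain ⟨s, K, hK, hlim⟩ := hg.exists_simpleFunc
  have hex : ∀ n, ∃ R, Q.IsIntegral (s n) R ∧ Q.IsIntegral (f * s n) (S * R) := by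
    intro n
    refine exists_isIntegral_simpleFunc (Q := Q) (s n)
      (p := fun g R => Q.IsIntegral g R ∧ Q.IsIntegral (f * g) (S * R))
      (fun B hB => ⟨Q.isIntegral_indicator hB, hS.mul_proj hf hB⟩)
      (fun c g R h => ⟨h.1.smul c, ?_⟩)
      (fun g h R T hg hh hR hT => ⟨hR.1.add hg hh hT.1, ?_⟩)
    · rw [mul_smul_comm, mul_smul_comm]
      exact h.2.smul c
    · rw [mul_add, mul_add]
      exact hR.2.add (hf.mul hg) (hf.mul hh) hT.2
  choose R hR hR' using hex
  intro ψ
  -- Moving `S` to the left as its adjoint reduces the product to weak convergence of the `R n`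
  -- alone.
  have h1 := IsIntegral.tendsto_inner (fun n => (s n).measurable) hK hlim hR hT
    (ContinuousLinearMap.adjoint S ψ) ψ
  have h2 : ∀ n, ⟪ContinuousLinearMap.adjoint S ψ, R n ψ⟫_ℂ =
      ∫ e, (f * s n) e ∂(Q.scalarMeasure ψ) := fun n => by
    rw [ContinuousLinearMap.adjoint_inner_left]
    exact hR' n ψ
  simp only [h2] at h1
  rw [ContinuousLinearMap.adjoint_inner_left] at h1
  refine tendsto_nhds_unique h1 ?_
  obtain ⟨hfm, C, hC⟩ := hf
  refine tendsto_integral_of_dominated_convergence (fun _ => C * K)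
      (fun n => (hfm.mul (s n).measurable).aestronglyMeasurable)
      (integrable_const _) (fun n => Eventually.of_forall fun x => ?_)
      (Eventually.of_forall fun x => (hlim x).const_mul _)
  rw [Pi.mul_apply, norm_mul]
  exact mul_le_mul (hC x) (hK n x) (norm_nonneg _) ((norm_nonneg _).trans (hC x))

theorem IsIntegral.commute_proj {f : ℝ → ℂ} {T : 𝓗 →L[ℂ] 𝓗} (hf : IsBddMeasurable f)
    (hT : Q.IsIntegral f T) {C : Set ℝ} (hC : MeasurableSet C) :
    T * Q.proj C = Q.proj C * T := by
  refine (hT.mul_proj hf hC).ext ?_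
  rw [mul_comm]
  exact (Q.isIntegral_indicator hC).mul (isBddMeasurable_indicator hC) hf hT

end ProjValuedMeasure

/-! ### The spectral measure lives on the spectrum. -/

namespace ProjValuedMeasure

open MeasureTheory Filter Topology

variable {𝓗 : Type} [NormedAddCommGroup 𝓗] [InnerProductSpace ℂ 𝓗] [CompleteSpace 𝓗]
variable (Q : ProjValuedMeasure 𝓗)

theorem ae_mem_of_proj_eq {B : Set ℝ} (hB : MeasurableSet B) {φ : 𝓗} (hφ : Q.proj B φ = φ) :
    ∀ᵐ e ∂(Q.scalarMeasure φ), e ∈ B := by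
  rw [ae_iff]
  change Q.scalarMeasure φ Bᶜ = 0
  rw [Q.scalarMeasure_apply hB.compl, ← hφ, Q.proj_proj hB.compl hB]
  simp [Q.proj_empty]

/-- The range of `Q.proj B` and its kernel are orthogonal and invariant under every `Q.proj C`, so
Pythagoras applies on each Borel set. -/
theorem scalarMeasure_add {B : Set ℝ} (hB : MeasurableSet B) {φ ψ : 𝓗} (hφ : Q.proj B φ = φ)
    (hψ : Q.proj B ψ = 0) :
    Q.scalarMeasure (ψ + φ) = Q.scalarMeasure ψ + Q.scalarMeasure φ := by
  ext C hC
  have h : ⟪Q.proj C ψ, Q.proj C φ⟫_ℂ = 0 := by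
    rw [← hφ, Q.proj_proj hC hB, Set.inter_comm, ← Q.proj_proj hB hC, ← Q.inner_proj_left hB,
      Q.proj_proj hB hC, Set.inter_comm, ← Q.proj_proj hC hB, hψ, map_zero, inner_zero_left]
  rw [Measure.add_apply, Q.scalarMeasure_apply hC, Q.scalarMeasure_apply hC,
    Q.scalarMeasure_apply hC, ← ENNReal.ofReal_add (by positivity) (by positivity), map_add]
  congr 1
  have := norm_add_sq_eq_norm_sq_add_norm_sq_of_inner_eq_zero _ _ h
  simpa only [sq] using this

variable {Q} {H : 𝓗 →ₗ.[ℂ] 𝓗}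

theorem IsSpectralMeasureOf.mem_domain_of_proj_eq (hQ : Q.IsSpectralMeasureOf H) {a b : ℝ}
    {φ : 𝓗} (hφ : Q.proj (Set.Ioo a b) φ = φ) : φ ∈ H.domain := by
  rw [hQ.1]
  refine Integrable.of_bound (by fun_prop) ((|a| + |b|) ^ 2) ?_
  filter_upwards [Q.ae_mem_of_proj_eq measurableSet_Ioo hφ] with e he
  rw [norm_pow]
  refine pow_le_pow_left₀ (norm_nonneg _) ?_ 2
  rw [Real.norm_eq_abs, abs_le]
  constructor
  · linarith [neg_abs_le a, abs_nonneg b, he.1]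
  · linarith [le_abs_self b, abs_nonneg a, he.2]

/-- The spectral subspaces of bounded intervals are invariant. -/
theorem IsSpectralMeasureOf.proj_apply (hQ : Q.IsSpectralMeasureOf H) (hH : IsSelfAdjoint H)
    {a b : ℝ} {φ : H.domain} (hφ : Q.proj (Set.Ioo a b) (φ : 𝓗) = φ) :
    Q.proj (Set.Ioo a b) (H φ) = H φ := by
  set B := Set.Ioo a b with hB_def
  have hB : MeasurableSet B := measurableSet_Ioo
  have hmem : ∀ ψ : 𝓗, Q.proj B ψ ∈ H.domain := fun ψ =>
    hQ.mem_domain_of_proj_eq (by rw [Q.proj_proj hB hB, Set.inter_self])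
  have hint : ∀ ψ : H.domain, Integrable (fun e : ℝ => e) (Q.scalarMeasure (ψ : 𝓗)) := by
    intro ψ
    have h2 := (hQ.1 ψ).1 ψ.2
    refine Integrable.mono' ((integrable_const 1).add h2) (by fun_prop)
      (Eventually.of_forall fun e => ?_)
    simp only [Pi.add_apply, Real.norm_eq_abs]
    nlinarith [sq_abs e, sq_nonneg (|e| - 1), abs_nonneg e]
  -- Additivity of the scalar measures makes the energy form additive on `ψ + z • φ`, so its cross
  -- terms cancel. Taking `z = 1` and `z = I` isolates a single cross term.
  have horth : ∀ (ψ : H.domain), Q.proj B (ψ : 𝓗) = 0 → ⟪(ψ : 𝓗), H φ⟫_ℂ = 0 := by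
    intro ψ hψ
    have key : ∀ z : ℂ, ⟪(ψ : 𝓗), H (z • φ)⟫_ℂ + ⟪((z • φ : H.domain) : 𝓗), H ψ⟫_ℂ = 0 := by
      intro z
      have hz : Q.proj B ((z • φ : H.domain) : 𝓗) = ((z • φ : H.domain) : 𝓗) := by
        rw [Submodule.coe_smul, map_smul, hφ]
      have h1 := hQ.2 (ψ + z • φ)
      rw [Submodule.coe_add, Q.scalarMeasure_add hB hz hψ,
        integral_add_measure (hint ψ) (hint (z • φ)), Complex.ofReal_add, ← hQ.2, ← hQ.2,
        LinearPMap.map_add, inner_add_left, inner_add_right, inner_add_right] at h1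
      linear_combination h1
    have k1 := key 1
    have k2 := key Complex.I
    rw [LinearPMap.map_smul, Submodule.coe_smul, inner_smul_left, inner_smul_right] at k1 k2
    simp only [map_one, one_mul, Complex.conj_I] at k1 k2
    have : 2 * ⟪(ψ : 𝓗), H φ⟫_ℂ = 0 := by
      linear_combination k1 - Complex.I * k2 +
        (⟪(ψ : 𝓗), H φ⟫_ℂ - ⟪(φ : 𝓗), H ψ⟫_ℂ) * Complex.I_mul_I
    simpa using this
  have hzero : ∀ v : 𝓗, v ∈ H.domain → ⟪H φ - Q.proj B (H φ), v⟫_ℂ = 0 := by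
    intro v hv
    have hmem' : v - Q.proj B v ∈ H.domain := H.domain.sub_mem hv (hmem v)
    have h0 : Q.proj B (v - Q.proj B v) = 0 := by
      rw [map_sub, Q.proj_proj hB hB, Set.inter_self, sub_self]
    have h1 : ⟪v - Q.proj B v, H φ⟫_ℂ = 0 := horth ⟨_, hmem'⟩ h0
    rw [inner_sub_left, Q.inner_proj_left hB, ← inner_sub_right, ← inner_conj_symm, h1,
      map_zero]
  have := hH.dense_domain.eq_zero_of_inner_left (𝕜 := ℂ) (x := H φ - Q.proj B (H φ)) hzero
  exact (sub_eq_zero.1 this).symm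

/-- Resolvent points have a neighbourhood of spectral measure zero. -/
theorem IsSpectralMeasureOf.exists_proj_eq_zero (hQ : Q.IsSpectralMeasureOf H)
    (hH : IsSelfAdjoint H) {e : ℝ} (he : InResolventSet H e) :
    ∃ δ > 0, Q.proj (Set.Ioo (e - δ) (e + δ)) = 0 := by
  obtain ⟨R, -, hR⟩ := he
  -- The resolvent gives `‖φ‖ ≤ c * ‖(H - e) φ‖`, while `H - e` has norm at most `δ` on the spectral
  -- subspace of the `δ`-interval. With `δ = 1 / (2 * c)` only `φ = 0` is left.
  set c := ‖R‖ + 1 with hc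
  have hc0 : 0 < c := by positivity
  have hδ : 0 < 1 / (2 * c) := by positivity
  refine ⟨1 / (2 * c), hδ, ?_⟩
  set δ := 1 / (2 * c) with hδ_def
  set B := Set.Ioo (e - δ) (e + δ) with hB_def
  have hB : MeasurableSet B := measurableSet_Ioo
  have hsymm : ∀ φ ψ : H.domain, ⟪H φ, (ψ : 𝓗)⟫_ℂ = ⟪(φ : 𝓗), H ψ⟫_ℂ := by
    intro φ ψ
    have h := LinearPMap.adjoint_isFormalAdjoint hH.dense_domain
    rw [LinearPMap.isSelfAdjoint_def.1 hH] at h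
    exact h φ ψ
  have hq : ∀ φ : H.domain, Q.proj B (φ : 𝓗) = φ →
      |(⟪(φ : 𝓗), H φ - (e : ℂ) • (φ : 𝓗)⟫_ℂ).re| ≤ δ * ‖(φ : 𝓗)‖ ^ 2 := by
    intro φ hφ
    have hae := Q.ae_mem_of_proj_eq hB hφ
    have hint : Integrable (fun x : ℝ => x) (Q.scalarMeasure (φ : 𝓗)) := by
      refine Integrable.of_bound (by fun_prop) (|e| + δ) ?_
      filter_upwards [hae] with x hx
      rw [Real.norm_eq_abs, abs_le]
      constructor
      · linarith [neg_abs_le e, hx.1]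
      · linarith [le_abs_self e, hx.2]
    have h1 : (⟪(φ : 𝓗), H φ - (e : ℂ) • (φ : 𝓗)⟫_ℂ).re =
        ∫ x, (x - e) ∂(Q.scalarMeasure (φ : 𝓗)) := by
      rw [inner_sub_right, hQ.2, inner_smul_right, inner_self_eq_norm_sq_to_K,
        integral_sub hint (integrable_const _), integral_const, Q.scalarMeasure_real_univ]
      simp only [Complex.sub_re, Complex.ofReal_re, smul_eq_mul, Complex.coe_algebraMap]
      norm_cast
      ring_nf
    rw [h1, ← Q.scalarMeasure_real_univ]
    refine norm_integral_le_of_norm_le_const (μ := Q.scalarMeasure (φ : 𝓗)) (G := ℝ)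
      (f := fun x => x - e) ?_
    filter_upwards [hae] with x hx
    rw [Real.norm_eq_abs, abs_le]
    exact ⟨by linarith [hx.1], by linarith [hx.2]⟩
  have hzero : ∀ φ : 𝓗, Q.proj B φ = φ → φ = 0 := by
    intro φ₀ hφ
    have hmem := hQ.mem_domain_of_proj_eq hφ
    obtain ⟨φ, rfl⟩ : ∃ φ : H.domain, (φ : 𝓗) = φ₀ := ⟨⟨φ₀, hmem⟩, rfl⟩
    set η := H φ - (e : ℂ) • (φ : 𝓗) with hη
    have hBη : Q.proj B η = η := by
      rw [hη, map_sub, map_smul, hφ, hQ.proj_apply hH hφ]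
    have hηmem := hQ.mem_domain_of_proj_eq hBη
    -- The form bound becomes a bound on `‖η‖` by polarizing with `χ ± φ`. The factor `c` makes `‖χ‖
    -- = c * ‖η‖`, the same bound that `‖φ‖` satisfies.
    let χ : H.domain := (c : ℂ) • ⟨η, hηmem⟩
    have hχ : (χ : 𝓗) = (c : ℂ) • η := rfl
    have hBχ : Q.proj B (χ : 𝓗) = χ := by rw [hχ, map_smul, hBη]
    have hp := hq (χ + φ) (by rw [Submodule.coe_add, map_add, hBχ, hφ])
    have hm := hq (χ - φ) (by rw [Submodule.coe_sub, map_sub, hBχ, hφ])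
    have hpar := parallelogram_law_with_norm ℂ (χ : 𝓗) (φ : 𝓗)
    have hcross : (⟪((χ + φ : H.domain) : 𝓗), H (χ + φ) - (e : ℂ) • ((χ + φ : H.domain) : 𝓗)⟫_ℂ).re
        - (⟪((χ - φ : H.domain) : 𝓗), H (χ - φ) - (e : ℂ) • ((χ - φ : H.domain) : 𝓗)⟫_ℂ).re
        = 4 * (c * ‖η‖ ^ 2) := by
      have h1 : (⟪(χ : 𝓗), η⟫_ℂ).re = c * ‖η‖ ^ 2 := by
        rw [hχ, inner_smul_left, Complex.conj_ofReal, Complex.re_ofReal_mul]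
        congr 1
        exact inner_self_eq_norm_sq (𝕜 := ℂ) η
      have h2 : ⟪(φ : 𝓗), H χ - (e : ℂ) • (χ : 𝓗)⟫_ℂ = starRingEnd ℂ ⟪(χ : 𝓗), η⟫_ℂ := by
        rw [inner_conj_symm, hη, inner_sub_left, inner_sub_right, ← hsymm, inner_smul_left,
          inner_smul_right, Complex.conj_ofReal]
      have h2' := congrArg Complex.re h2
      rw [Complex.conj_re, h1] at h2'
      rw [LinearPMap.map_add, LinearPMap.map_sub, Submodule.coe_add, Submodule.coe_sub]
      have e1 : H χ + H φ - (e : ℂ) • ((χ : 𝓗) + φ) = (H χ - (e : ℂ) • (χ : 𝓗)) + η := by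
        rw [hη, smul_add]; abel
      have e2 : H χ - H φ - (e : ℂ) • ((χ : 𝓗) - φ) = (H χ - (e : ℂ) • (χ : 𝓗)) - η := by
        rw [hη, smul_sub]; abel
      rw [e1, e2]
      generalize H χ - (e : ℂ) • (χ : 𝓗) = κ at h2'
      simp only [inner_add_left, inner_sub_left, inner_add_right, inner_sub_right, Complex.add_re,
        Complex.sub_re]
      rw [h1, h2']
      ring
    have hRφ : ‖(φ : 𝓗)‖ ≤ c * ‖η‖ := by
      have h := hR φ
      rw [← hη] at h
      rw [← h]
      refine (R.le_opNorm η).trans ?_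
      gcongr
      linarith
    have hχn : ‖(χ : 𝓗)‖ = c * ‖η‖ := by
      rw [hχ, norm_smul, Complex.norm_real, Real.norm_of_nonneg hc0.le]
    rw [Submodule.coe_add] at hp
    rw [Submodule.coe_sub] at hm
    have hbound : 4 * (c * ‖η‖ ^ 2) ≤ δ * (2 * (‖(χ : 𝓗)‖ ^ 2 + ‖(φ : 𝓗)‖ ^ 2)) := by
      rw [← hpar, ← hcross]
      have := (abs_le.1 hp).2
      have := (abs_le.1 hm).1
      rw [Submodule.coe_add, Submodule.coe_sub]
      nlinarith
    have hδc : δ * c = 1 / 2 := by rw [hδ_def]; field_simp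
    have hη0 : ‖η‖ = 0 := by
      have h1 : 4 * (c * ‖η‖ ^ 2) ≤ 2 * (c * ‖η‖ ^ 2) := by
        calc 4 * (c * ‖η‖ ^ 2) ≤ δ * (2 * (‖(χ : 𝓗)‖ ^ 2 + ‖(φ : 𝓗)‖ ^ 2)) := hbound
          _ ≤ δ * (2 * ((c * ‖η‖) ^ 2 + (c * ‖η‖) ^ 2)) := by
            rw [hχn]; gcongr
          _ = (δ * c) * 4 * (c * ‖η‖ ^ 2) := by ring
          _ = 2 * (c * ‖η‖ ^ 2) := by rw [hδc]; ring
      have h2 : c * ‖η‖ ^ 2 ≤ 0 := by linarith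
      have h3 : ‖η‖ ^ 2 ≤ 0 := by
        by_contra h
        exact absurd h2 (not_le.2 (mul_pos hc0 (not_le.1 h)))
      exact pow_eq_zero_iff two_ne_zero |>.1 (le_antisymm h3 (sq_nonneg _))
    rw [hη0, mul_zero] at hRφ
    exact norm_le_zero_iff.1 hRφ
  ext ψ
  exact hzero _ (by rw [Q.proj_proj hB hB, Set.inter_self])

/-- A vector in this subspace has energy at most `b * ‖φ‖ ^ 2`, which is negative unless `φ = 0`. -/
theorem IsSpectralMeasureOf.proj_eq_zero_of_neg (hQ : Q.IsSpectralMeasureOf H)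
    (hH : ∀ ψ : H.domain, 0 ≤ (⟪(ψ : 𝓗), H ψ⟫_ℂ).re) {a b : ℝ} (hb : b < 0) :
    Q.proj (Set.Ioo a b) = 0 := by
  have hB : MeasurableSet (Set.Ioo a b) := measurableSet_Ioo
  ext ψ
  set φ := Q.proj (Set.Ioo a b) ψ with hφ_def
  have hφ : Q.proj (Set.Ioo a b) φ = φ := by rw [hφ_def, Q.proj_proj hB hB, Set.inter_self]
  have hmem := hQ.mem_domain_of_proj_eq hφ
  have hae := Q.ae_mem_of_proj_eq hB hφ
  have h1 := hH ⟨φ, hmem⟩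
  rw [hQ.2, Complex.ofReal_re] at h1
  have h2 : ∫ x, x ∂(Q.scalarMeasure φ) ≤ ∫ _, b ∂(Q.scalarMeasure φ) := by
    refine integral_mono_ae ?_ (integrable_const _) ?_
    · refine Integrable.of_bound (by fun_prop) (|a| + |b|) ?_
      filter_upwards [hae] with x hx
      rw [Real.norm_eq_abs, abs_le]
      constructor
      · linarith [neg_abs_le a, abs_nonneg b, hx.1]
      · linarith [le_abs_self b, abs_nonneg a, hx.2]
    · filter_upwards [hae] with x hx
      exact hx.2.le
  rw [integral_const, Q.scalarMeasure_real_univ, smul_eq_mul] at h2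
  have h3 : 0 ≤ ‖φ‖ ^ 2 * b := h1.trans h2
  have h4 : ‖φ‖ ^ 2 ≤ 0 := by
    by_contra h
    exact absurd h3 (not_le.2 (mul_neg_of_pos_of_neg (not_le.1 h) hb))
  have h5 : ‖φ‖ = 0 := pow_eq_zero_iff two_ne_zero |>.1 (le_antisymm h4 (sq_nonneg _))
  simpa using h5

/-- Below `Eplus` the spectral measure is carried by the spectrum. -/
theorem IsSpectralMeasureOf.scalarMeasure_compl_eq_zero (hQ : Q.IsSpectralMeasureOf H)
    (hH : IsSelfAdjoint H) (hpos : ∀ ψ : H.domain, 0 ≤ (⟪(ψ : 𝓗), H ψ⟫_ℂ).re) {Eplus : ℝ}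
    {Z : Set ℝ} (hZ : realSpectrum H ∩ Set.Ico 0 Eplus = Z) (ψ : 𝓗) :
    Q.scalarMeasure ψ (Z ∪ Set.Ici Eplus)ᶜ = 0 := by
  -- On the line a locally null set is null, so one null interval around each point suffices:
  -- negative energies by positivity of `H`, the others by the resolvent.
  refine measure_null_of_locally_null _ fun e he => ?_
  simp only [Set.mem_compl_iff, Set.mem_union, Set.mem_Ici, not_or, not_le] at he
  obtain ⟨a, b, ha, hb, hab⟩ : ∃ a b, a < e ∧ e < b ∧ Q.proj (Set.Ioo a b) = 0 := by
    rcases lt_or_ge e 0 with hneg | hge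
    · exact ⟨e - 1, e / 2, by linarith, by linarith, hQ.proj_eq_zero_of_neg hpos (by linarith)⟩
    · have hres : InResolventSet H e := by
        by_contra h
        exact he.1 (hZ ▸ ⟨h, hge, he.2⟩)
      obtain ⟨δ, hδ, h⟩ := hQ.exists_proj_eq_zero hH hres
      exact ⟨e - δ, e + δ, by linarith, by linarith, h⟩
  refine ⟨Set.Ioo a b, mem_nhdsWithin_of_mem_nhds (Ioo_mem_nhds ha hb), ?_⟩
  rw [Q.scalarMeasure_apply measurableSet_Ioo, hab]
  simp

end ProjValuedMeasure

/-! ### Cyclicity of the trace through Hilbert-Schmidt operators. -/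

section HilbertSchmidt

/-- Interchange of the two iterated sums of a product of square-summable double sequences. -/
theorem exists_hasSum_of_sq_summable {ι : Type*} {c d : ι × ι → ℂ}
    (hc : Summable fun q => ‖c q‖ ^ 2) (hd : Summable fun q => ‖d q‖ ^ 2) {x y : ι → ℂ}
    (hx : ∀ j, HasSum (fun i => c (j, i) * d (j, i)) (x j))
    (hy : ∀ i, HasSum (fun j => c (j, i) * d (j, i)) (y i)) :
    ∃ z, HasSum x z ∧ HasSum y z := by
  have hle : ∀ q, ‖c q * d q‖ ≤ ‖c q‖ ^ 2 + ‖d q‖ ^ 2 := fun q => by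
    rw [norm_mul]
    nlinarith [sq_nonneg (‖c q‖ - ‖d q‖), sq_nonneg ‖c q‖, sq_nonneg ‖d q‖]
  have hF : Summable fun q => c q * d q := Summable.of_norm_bounded (hc.add hd) hle
  obtain ⟨z, hz⟩ := hF
  have hz' : HasSum (fun q : ι × ι => c (q.2, q.1) * d (q.2, q.1)) z :=
    (Equiv.prodComm ι ι).hasSum_iff.2 hz
  exact ⟨z, hz.prod_fiberwise hx, hz'.prod_fiberwise hy⟩

variable {𝓗 : Type} [NormedAddCommGroup 𝓗] [InnerProductSpace ℂ 𝓗] {ι : Type}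

theorem HilbertBasis.hasSum_norm_inner_sq (b : HilbertBasis ι ℂ 𝓗) (x : 𝓗) :
    HasSum (fun i => ‖⟪b i, x⟫_ℂ‖ ^ 2) (‖x‖ ^ 2) := by
  have h := (b.hasSum_inner_mul_inner x x).mapL Complex.reCLM
  have h2 : (⟪x, x⟫_ℂ).re = ‖x‖ ^ 2 := inner_self_eq_norm_sq (𝕜 := ℂ) x
  simp only [Complex.reCLM_apply, h2] at h
  convert h using 2 with i
  rw [← inner_conj_symm x, ← Complex.normSq_eq_norm_sq, ← Complex.normSq_eq_conj_mul_self,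
    Complex.ofReal_re]

theorem HilbertBasis.summable_norm_inner_apply_sq (b : HilbertBasis ι ℂ 𝓗)
    {T : 𝓗 →L[ℂ] 𝓗} (hT : Summable fun j => ‖T (b j)‖ ^ 2) :
    Summable fun q : ι × ι => ‖⟪b q.2, T (b q.1)⟫_ℂ‖ ^ 2 := by
  rw [summable_prod_of_nonneg (fun _ => by positivity)]
  refine ⟨fun j => (b.hasSum_norm_inner_sq (T (b j))).summable, ?_⟩
  simpa only [(b.hasSum_norm_inner_sq _).tsum_eq] using hT

/-- Cyclicity of the trace for a product of two Hilbert-Schmidt operators. -/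
theorem HilbertBasis.exists_hasSum_inner_adjoint [CompleteSpace 𝓗]
    (b : HilbertBasis ι ℂ 𝓗) {S T : 𝓗 →L[ℂ] 𝓗}
    (hS : Summable fun j => ‖S (b j)‖ ^ 2) (hT : Summable fun j => ‖T (b j)‖ ^ 2) :
    ∃ z, HasSum (fun j => ⟪S (b j), T (b j)⟫_ℂ) z ∧
      HasSum (fun i => ⟪ContinuousLinearMap.adjoint T (b i),
        ContinuousLinearMap.adjoint S (b i)⟫_ℂ) z := by
  have h1 : ∀ j, HasSum (fun i => ⟪S (b j), b i⟫_ℂ * ⟪b i, T (b j)⟫_ℂ) ⟪S (b j), T (b j)⟫_ℂ :=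
    fun j => b.hasSum_inner_mul_inner _ _
  have h2 : ∀ i, HasSum (fun j => ⟪S (b j), b i⟫_ℂ * ⟪b i, T (b j)⟫_ℂ)
      ⟪ContinuousLinearMap.adjoint T (b i), ContinuousLinearMap.adjoint S (b i)⟫_ℂ := by
    intro i
    have h := b.hasSum_inner_mul_inner (ContinuousLinearMap.adjoint T (b i))
      (ContinuousLinearMap.adjoint S (b i))
    simp only [ContinuousLinearMap.adjoint_inner_left,
      ContinuousLinearMap.adjoint_inner_right _ (b _)] at h
    rw [ContinuousLinearMap.adjoint_inner_left]
    simpa only [mul_comm] using h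
  have hS' := b.summable_norm_inner_apply_sq hS
  simp only [norm_inner_symm (b _)] at hS'
  exact exists_hasSum_of_sq_summable (c := fun q => ⟪S (b q.1), b q.2⟫_ℂ)
    (d := fun q => ⟪b q.2, T (b q.1)⟫_ℂ) hS' (b.summable_norm_inner_apply_sq hT) h1 h2

end HilbertSchmidt

/-! ### Compressing effects to finite matrices. -/

section VectorFunctional

variable {𝓗 : Type} [NormedAddCommGroup 𝓗] [InnerProductSpace ℂ 𝓗]
variable {ι : Type}

theorem summable_inner_apply {v : ι → 𝓗} (hv : Summable fun i => ‖v i‖ ^ 2) (T : 𝓗 →L[ℂ] 𝓗) :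
    Summable fun i => ⟪v i, T (v i)⟫_ℂ := by
  refine Summable.of_norm_bounded (hv.mul_left ‖T‖) fun i => ?_
  calc ‖⟪v i, T (v i)⟫_ℂ‖ ≤ ‖v i‖ * ‖T (v i)‖ := norm_inner_le_norm _ _
    _ ≤ ‖v i‖ * (‖T‖ * ‖v i‖) := by gcongr; exact T.le_opNorm _
    _ = ‖T‖ * ‖v i‖ ^ 2 := by ring

/-- The positive functional `T ↦ ∑ i, ⟨v i, T (v i)⟩` of a square-summable family of vectors. -/
def vectorFunctional (v : ι → 𝓗) (hv : Summable fun i => ‖v i‖ ^ 2) : (𝓗 →L[ℂ] 𝓗) →ₗ[ℂ] ℂ where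
  toFun T := ∑' i, ⟪v i, T (v i)⟫_ℂ
  map_add' S T := by
    rw [← (summable_inner_apply hv S).tsum_add (summable_inner_apply hv T)]
    simp only [add_apply, inner_add_right]
  map_smul' c T := by
    simp only [smul_apply, inner_smul_right, RingHom.id_apply, smul_eq_mul, tsum_mul_left]

variable {v : ι → 𝓗} (hv : Summable fun i => ‖v i‖ ^ 2)

theorem hasSum_vectorFunctional (T : 𝓗 →L[ℂ] 𝓗) :
    HasSum (fun i => ⟪v i, T (v i)⟫_ℂ) (vectorFunctional v hv T) :=
  (summable_inner_apply hv T).hasSum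

theorem vectorFunctional_nonneg {T : 𝓗 →L[ℂ] 𝓗} (hT : T.IsPositive) :
    0 ≤ vectorFunctional v hv T :=
  (hasSum_vectorFunctional hv T).nonneg fun _ => hT.inner_nonneg_right _

theorem vectorFunctional_star [CompleteSpace 𝓗] (T : 𝓗 →L[ℂ] 𝓗) :
    vectorFunctional v hv (star T) = star (vectorFunctional v hv T) := by
  refine (hasSum_vectorFunctional hv (star T)).unique ?_
  convert (hasSum_vectorFunctional hv T).star using 2 with i
  rw [ContinuousLinearMap.star_eq_adjoint, ContinuousLinearMap.adjoint_inner_right,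
    ← inner_conj_symm]
  rfl

/-- The compression of the operator `F` along the family `V`. -/
def compressionMatrix [CompleteSpace 𝓗] {κ : Type*} (V : κ → 𝓗 →L[ℂ] 𝓗) (F : 𝓗 →L[ℂ] 𝓗) :
    Matrix κ κ ℂ :=
  Matrix.of fun u w => vectorFunctional v hv (star (V u) * F * V w)

variable [CompleteSpace 𝓗] {κ : Type*} (V : κ → 𝓗 →L[ℂ] 𝓗)

/-- This one identity serves twice: it yields positivity of the compression, and, when the
combination of the `V u` is the evolution operator, the outcome probability. -/
theorem dotProduct_compressionMatrix [Fintype κ] (F : 𝓗 →L[ℂ] 𝓗) (c : κ → ℂ) :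
    star c ⬝ᵥ (compressionMatrix hv V F *ᵥ c) =
      vectorFunctional v hv (star (∑ u, c u • V u) * F * ∑ u, c u • V u) := by
  rw [star_sum, Finset.sum_mul, Finset.sum_mul, map_sum]
  refine Finset.sum_congr rfl fun u _ => ?_
  rw [Finset.mul_sum, map_sum, Matrix.mulVec, dotProduct, Finset.mul_sum]
  refine Finset.sum_congr rfl fun w _ => ?_
  rw [star_smul, smul_mul_assoc, smul_mul_assoc, mul_smul_comm, map_smul, map_smul]
  simp only [Pi.star_apply, compressionMatrix, Matrix.of_apply, smul_eq_mul]
  ring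

theorem posSemidef_compressionMatrix [Fintype κ] {F : 𝓗 →L[ℂ] 𝓗} (hF : F.IsPositive) :
    (compressionMatrix hv V F).PosSemidef := by
  refine Matrix.PosSemidef.of_dotProduct_mulVec_nonneg ?_ fun c => ?_
  · ext u w
    have hF' : star F = F := hF.isSelfAdjoint
    rw [Matrix.conjTranspose_apply, compressionMatrix, Matrix.of_apply, Matrix.of_apply,
      ← vectorFunctional_star, star_mul, star_mul, star_star, hF', mul_assoc]
  · rw [dotProduct_compressionMatrix]
    have h := hF.adjoint_conj (∑ u, c u • V u)
    rw [← ContinuousLinearMap.star_eq_adjoint] at h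
    rw [mul_assoc]
    exact vectorFunctional_nonneg hv h

theorem sum_compressionMatrix {A : ℕ} (F : Fin A → 𝓗 →L[ℂ] 𝓗) (hF : ∑ a, F a = 1) :
    ∑ a, compressionMatrix hv V (F a) =
      Matrix.of fun u w => vectorFunctional v hv (star (V u) * V w) := by
  ext u w
  rw [Matrix.sum_apply]
  simp only [compressionMatrix, Matrix.of_apply]
  rw [← map_sum, ← Finset.sum_mul, ← Finset.mul_sum, hF, mul_one]

end VectorFunctional

/-! ### Compactness of the set of certificates. -/

section Feasibility

/-- The triples `(p, γ, M)` that certify a dataset, with the normalization `γ j j = p m`. -/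
def certificates (A X : ℕ) {N : ℕ} (m : ℕ) (ε : ℝ) (t : Fin N → ℝ) :
    Set ((Fin (m + 1) → ℝ) × Matrix (Fin N) (Fin N) ℂ ×
      (Fin A → Fin X → Matrix (Fin m ⊕ Fin N) (Fin m ⊕ Fin N) ℂ)) :=
  {c | (∀ k, 0 ≤ c.1 k) ∧ ∑ k, c.1 k = 1 ∧ c.2.1 ∈ decayMatrices t ∧ c.1 (Fin.last m) ≤ ε ∧
    (∀ a x, (c.2.2 a x).PosSemidef) ∧
    (∀ x, ∑ a, c.2.2 a x =
      Matrix.fromBlocks (Matrix.diagonal fun k : Fin m => (c.1 k.castSucc : ℂ)) 0 0 c.2.1) ∧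
    ∀ j, c.2.1 j j = c.1 (Fin.last m)}

variable {A X N m : ℕ} {ε : ℝ} {t : Fin N → ℝ}

theorem isCompact_setOf_norm_apply_le (n : Type*) [Finite n] :
    IsCompact {M : Matrix n n ℂ | ∀ i j, ‖M i j‖ ≤ 1} := by
  have h := isCompact_univ_pi fun _ : n => isCompact_univ_pi fun _ : n =>
    isCompact_closedBall (0 : ℂ) 1
  change IsCompact {M : n → n → ℂ | ∀ i j, ‖M i j‖ ≤ 1}
  convert h using 1
  ext M
  simp [Set.mem_pi]

theorem isClosed_setOf_posSemidef (n : Type*) [Fintype n] :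
    IsClosed {M : Matrix n n ℂ | M.PosSemidef} := by
  have : {M : Matrix n n ℂ | M.PosSemidef} =
      {M | Mᴴ = M} ∩ ⋂ x : n → ℂ, {M | 0 ≤ star x ⬝ᵥ (M *ᵥ x)} := by
    ext M
    simp only [Set.mem_ofPred_eq, Set.mem_inter_iff, Set.mem_iInter]
    exact Matrix.posSemidef_iff_dotProduct_mulVec
  rw [this]
  refine (isClosed_eq (by fun_prop) continuous_id).inter (isClosed_iInter fun x => ?_)
  exact isClosed_le continuous_const (by fun_prop)

theorem isClosed_certificates : IsClosed (certificates A X m ε t) := by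
  have h : certificates A X m ε t = {c | ∀ k, 0 ≤ c.1 k} ∩ {c | ∑ k, c.1 k = 1} ∩
      {c | c.2.1 ∈ decayMatrices t} ∩ {c | c.1 (Fin.last m) ≤ ε} ∩
      {c | ∀ a x, (c.2.2 a x).PosSemidef} ∩
      {c | ∀ x, ∑ a, c.2.2 a x =
        Matrix.fromBlocks (Matrix.diagonal fun k : Fin m => (c.1 k.castSucc : ℂ)) 0 0 c.2.1} ∩
      {c | ∀ j, c.2.1 j j = c.1 (Fin.last m)} := by
    ext c
    simp only [certificates, Set.mem_ofPred_eq, Set.mem_inter_iff, and_assoc]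
  rw [h]
  simp only [Set.ofPred_forall]
  refine (((((IsClosed.inter ?_ ?_).inter ?_).inter ?_).inter ?_).inter ?_).inter ?_
  · exact isClosed_iInter fun k => isClosed_le continuous_const (by fun_prop)
  · exact isClosed_eq (by fun_prop) continuous_const
  · exact isClosed_closure.preimage (by fun_prop)
  · exact isClosed_le (by fun_prop) continuous_const
  · exact isClosed_iInter fun a => isClosed_iInter fun x =>
      (isClosed_setOf_posSemidef _).preimage (by fun_prop)
  · refine isClosed_iInter fun x => isClosed_eq (by fun_prop) ?_
    refine Continuous.matrix_fromBlocks ?_ continuous_const continuous_const (by fun_prop)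
    refine Continuous.matrix_diagonal ?_
    fun_prop
  · refine isClosed_iInter fun j => isClosed_eq ?_ (by fun_prop)
    exact Continuous.matrix_elem (by fun_prop) j j

/-- The normalization `γ j j = p m` bounds the diagonal of the block matrix by `1`. Positivity
passes the bound to the diagonals of the summands, then to all their entries; those of `γ` are
bounded by its diagonal. -/
theorem isCompact_certificates : IsCompact (certificates A X m ε t) := by
  have hp : IsCompact {p : Fin (m + 1) → ℝ | ∀ k, p k ∈ Set.Icc 0 1} := by
    convert isCompact_univ_pi fun _ : Fin (m + 1) => isCompact_Icc (a := (0 : ℝ)) (b := 1) using 1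
    ext p
    simp only [Set.mem_ofPred_eq, Set.mem_pi, Set.mem_univ, true_imp_iff]
  have hM : IsCompact {M : Fin A → Fin X → Matrix (Fin m ⊕ Fin N) (Fin m ⊕ Fin N) ℂ |
      ∀ a x, M a x ∈ {M | ∀ i j, ‖M i j‖ ≤ 1}} := by
    convert isCompact_univ_pi fun _ : Fin A => isCompact_univ_pi fun _ : Fin X =>
      isCompact_setOf_norm_apply_le (Fin m ⊕ Fin N) using 1
    ext M
    simp only [Set.mem_ofPred_eq, Set.mem_pi, Set.mem_univ, true_imp_iff]
  refine (hp.prod ((isCompact_setOf_norm_apply_le (Fin N)).prod hM)).of_isClosed_subset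
    isClosed_certificates ?_
  rintro ⟨p, γ, M⟩ ⟨h0, h1, hγ, -, hpsd, hsum, hdiag⟩
  have hp1 : ∀ k, p k ≤ 1 := fun k => by
    have h1' : ∑ k, p k = 1 := h1
    rw [← h1']
    exact Finset.single_le_sum (fun k _ => h0 k) (Finset.mem_univ k)
  have hdiag' : ∀ j, γ j j = p (Fin.last m) := hdiag
  refine ⟨fun k => ⟨h0 k, hp1 k⟩, fun j k => ?_, fun a x => ?_⟩
  · have h := norm_apply_le_of_mem_closure (I := Set.univ) (t := t) (γ := γ)
      (by rw [← decayMatricesOn_eq_closure MeasurableSet.univ]; exact hγ) j k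
    rw [hdiag', Complex.ofReal_re] at h
    exact h.trans (hp1 _)
  · have hre : ∀ u, (M a x u u).re ≤ 1 := by
      intro u
      have hle : (M a x u u).re ≤ ∑ b, (M b x u u).re :=
        Finset.single_le_sum (f := fun b => (M b x u u).re)
          (fun b _ => (Complex.nonneg_iff.1 ((hpsd b x).diag_nonneg (i := u))).1)
          (Finset.mem_univ a)
      have hs : ∑ b, (M b x u u).re = (Matrix.fromBlocks
          (Matrix.diagonal fun k : Fin m => (p k.castSucc : ℂ)) 0 0 γ u u).re := by
        rw [← hsum x, Matrix.sum_apply, Complex.re_sum]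
      rw [hs] at hle
      refine hle.trans ?_
      cases u with
      | inl k => simpa using hp1 _
      | inr j => simpa [hdiag'] using hp1 _
    intro u w
    refine ((hpsd a x).norm_apply_le u w).trans ?_
    linarith [hre u, hre w]

/-- The dataset that a certificate describes. -/
def certifiedDataset (E : Fin m → ℝ) (t : Fin N → ℝ)
    (c : (Fin (m + 1) → ℝ) × Matrix (Fin N) (Fin N) ℂ ×
      (Fin A → Fin X → Matrix (Fin m ⊕ Fin N) (Fin m ⊕ Fin N) ℂ)) : Fin A → Fin X → Fin N → ℝ :=
  fun a x j => (star (probeVector E t j) ⬝ᵥ (c.2.2 a x *ᵥ probeVector E t j)).re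

theorem continuous_certifiedDataset (E : Fin m → ℝ) (t : Fin N → ℝ) :
    Continuous (certifiedDataset (A := A) (X := X) E t) := by
  refine continuous_pi fun a => continuous_pi fun x => continuous_pi fun j => ?_
  unfold certifiedDataset
  fun_prop

theorem isClosed_image_certifiedDataset (E : Fin m → ℝ) :
    IsClosed (certifiedDataset E t '' certificates A X m ε t) :=
  (isCompact_certificates.image (continuous_certifiedDataset E t)).isClosed

end Feasibility

/-! ### The evolution group and the resolution of the identity. -/

namespace ProjValuedMeasure

open MeasureTheory

variable {𝓗 : Type} [NormedAddCommGroup 𝓗] [InnerProductSpace ℂ 𝓗] [CompleteSpace 𝓗]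
variable {Q : ProjValuedMeasure 𝓗} {U : ℝ → 𝓗 →L[ℂ] 𝓗}

theorem isIntegral_one : Q.IsIntegral 1 1 := by
  have h := Q.isIntegral_indicator MeasurableSet.univ
  rwa [Set.indicator_univ, Q.proj_univ] at h

theorem conj_phase (e s : ℝ) : starRingEnd ℂ (Complex.exp (-Complex.I * e * s)) =
    Complex.exp (-Complex.I * e * (-s : ℝ)) := by
  rw [← Complex.exp_conj]
  simp

theorem star_evolution
    (hU : ∀ s : ℝ, Q.IsIntegral (fun e => Complex.exp (-Complex.I * e * s)) (U s)) (s : ℝ) :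
    star (U s) = U (-s) := by
  have h := (hU s).adjoint
  simp only [conj_phase] at h
  exact h.ext (hU (-s))

theorem evolution_mul
    (hU : ∀ s : ℝ, Q.IsIntegral (fun e => Complex.exp (-Complex.I * e * s)) (U s)) (s s' : ℝ) :
    U s * U s' = U (s + s') := by
  refine ((hU s).mul (isBddMeasurable_phase s) (isBddMeasurable_phase s') (hU s')).ext ?_
  convert hU (s + s') using 1
  funext e
  rw [Pi.mul_apply, ← Complex.exp_add]
  congr 1
  push_cast
  ring

theorem evolution_zero
    (hU : ∀ s : ℝ, Q.IsIntegral (fun e => Complex.exp (-Complex.I * e * s)) (U s)) :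
    U 0 = 1 := by
  refine (hU 0).ext ?_
  convert isIntegral_one (Q := Q) using 1
  funext e
  simp

theorem evolution_mul_proj_of_subset
    (hU : ∀ s : ℝ, Q.IsIntegral (fun e => Complex.exp (-Complex.I * e * s)) (U s)) (s : ℝ)
    {B : Set ℝ} (hB : MeasurableSet B) {e : ℝ} (hBe : B ⊆ {e}) :
    U s * Q.proj B = Complex.exp (-Complex.I * e * s) • Q.proj B := by
  refine ((hU s).mul_proj (isBddMeasurable_phase s) hB).ext ?_
  convert (Q.isIntegral_indicator hB).smul (Complex.exp (-Complex.I * e * s)) using 1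
  funext x
  by_cases hx : x ∈ B
  · obtain rfl : x = e := hBe hx
    simp [hx]
  · simp [hx]

/-- The group law and commutation with `Q.proj I` make the Gram matrix depend on time differences
only, as a decay matrix must. -/
theorem star_evolution_mul_proj
    (hU : ∀ s : ℝ, Q.IsIntegral (fun e => Complex.exp (-Complex.I * e * s)) (U s)) (s s' : ℝ)
    {I : Set ℝ} (hI : MeasurableSet I) :
    star (U s * Q.proj I) * (U s' * Q.proj I) = U (s' - s) * Q.proj I := by
  have hp : star (Q.proj I) = Q.proj I := (Q.isStarProjection I hI).isSelfAdjoint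
  have hi : Q.proj I * Q.proj I = Q.proj I := (Q.isStarProjection I hI).isIdempotentElem
  calc star (U s * Q.proj I) * (U s' * Q.proj I)
      = Q.proj I * (U (-s) * U s') * Q.proj I := by
        rw [star_mul, hp, star_evolution hU]
        simp only [mul_assoc]
    _ = U (s' - s) * Q.proj I := by
        rw [evolution_mul hU, ← (hU _).commute_proj (isBddMeasurable_phase _) hI, mul_assoc, hi,
          neg_add_eq_sub]

theorem sum_proj_add_proj_eq_one {ι : Type*} [Fintype ι] {B : ι → Set ℝ}
    (hB : ∀ k, MeasurableSet (B k)) (hd : Pairwise (Function.onFun Disjoint B)) {I : Set ℝ}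
    (hI : MeasurableSet I) (hBI : ∀ k, Disjoint (B k) I)
    (hnull : ∀ ψ, Q.scalarMeasure ψ ((⋃ k, B k) ∪ I)ᶜ = 0) :
    ∑ k, Q.proj (B k) + Q.proj I = 1 := by
  refine IsIntegral.ext (Q := Q) (f := 1) (fun ψ => ?_) isIntegral_one
  have hmeas : MeasurableSet (⋃ k, B k) := MeasurableSet.iUnion hB
  have h1 : (Q.scalarMeasure ψ).real Set.univ =
      ∑ k, (Q.scalarMeasure ψ).real (B k) + (Q.scalarMeasure ψ).real I := by
    rw [← measureReal_iUnion_fintype hd hB,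
      ← measureReal_union (Set.disjoint_iUnion_left.2 hBI) hI]
    refine measureReal_congr ?_
    exact (ae_eq_univ.2 (hnull ψ)).symm
  rw [add_apply, sum_apply, inner_add_right, inner_sum]
  simp only [Q.inner_proj_self (hB _), Q.inner_proj_self hI, ← Q.scalarMeasure_real (hB _),
    ← Q.scalarMeasure_real hI]
  simp only [Pi.one_apply, integral_const, h1]
  simp

end ProjValuedMeasure

/-! ### Energy levels listed with possible repetitions. -/

section LevelSets

variable {m : ℕ} (E : Fin m → ℝ)

/-- The singleton of `E k` if `k` is the first index with that value, and empty otherwise. -/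
def levelSet (k : Fin m) : Set ℝ := {e | e = E k ∧ ∀ l < k, E l ≠ E k}

theorem levelSet_subset (k : Fin m) : levelSet E k ⊆ {E k} := fun _ h => h.1

theorem measurableSet_levelSet (k : Fin m) : MeasurableSet (levelSet E k) :=
  (Set.subsingleton_singleton.anti (levelSet_subset E k)).measurableSet

theorem disjoint_levelSet {k l : Fin m} (h : k ≠ l) : Disjoint (levelSet E k) (levelSet E l) := by
  rw [Set.disjoint_left]
  rintro e ⟨h1, h2⟩ ⟨h3, h4⟩
  rcases lt_or_gt_of_ne h with h | h
  · exact h4 k h (h1.symm.trans h3)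
  · exact h2 l h (h3.symm.trans h1)

theorem iUnion_levelSet : ⋃ k, levelSet E k = Set.range E := by
  apply Set.Subset.antisymm
  · exact Set.iUnion_subset fun k e he => ⟨k, he.1.symm⟩
  · rintro _ ⟨k, rfl⟩
    -- The least index with a given value is the one that carries it.
    let s : Finset (Fin m) := Finset.univ.filter fun l => E l = E k
    have hs : s.Nonempty := ⟨k, by simp [s]⟩
    have hmem := s.min'_mem hs
    simp only [s, Finset.mem_filter, Finset.mem_univ, true_and] at hmem
    refine Set.mem_iUnion.2 ⟨s.min' hs, hmem.symm, fun l hl hne => ?_⟩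
    have : l ∈ s := by simp [s, hne, hmem]
    exact absurd (s.min'_le l this) (not_le.2 hl)

end LevelSets

/-! ### From realizations to certificates. -/

section Forward

variable {𝓗 : Type} [NormedAddCommGroup 𝓗] [InnerProductSpace ℂ 𝓗]

theorem exists_isSelfAdjoint_mul_self_eq [CompleteSpace 𝓗] {ρ : 𝓗 →L[ℂ] 𝓗} (hρ : ρ.IsPositive) :
    ∃ σ : 𝓗 →L[ℂ] 𝓗, star σ = σ ∧ σ * σ = ρ := by
  have h : 0 ≤ ρ := (ContinuousLinearMap.nonneg_iff_isPositive ρ).2 hρ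
  exact ⟨CFC.sqrt ρ, (CFC.sqrt_nonneg ρ).isSelfAdjoint, CFC.sqrt_mul_sqrt_self ρ h⟩

theorem summable_norm_apply_sq {ι : Type} {v : ι → 𝓗} (hv : Summable fun i => ‖v i‖ ^ 2)
    (K : 𝓗 →L[ℂ] 𝓗) : Summable fun i => ‖K (v i)‖ ^ 2 := by
  refine Summable.of_nonneg_of_le (fun i => by positivity) (fun i => ?_) (hv.mul_left (‖K‖ ^ 2))
  rw [← mul_pow]
  exact pow_le_pow_left₀ (norm_nonneg _) (K.le_opNorm _) 2

/-- With `σ` Hilbert-Schmidt, the trace is that of `(G σ) (F G σ)*`, and cyclicity turns it into a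
sum over the vectors `σ (b i)`. -/
theorem HasTrace.eq_vectorFunctional [CompleteSpace 𝓗] {ι : Type} {b : HilbertBasis ι ℂ 𝓗}
    {σ : 𝓗 →L[ℂ] 𝓗} (hσ : star σ = σ) (hv : Summable fun i => ‖σ (b i)‖ ^ 2) {G F : 𝓗 →L[ℂ] 𝓗} (hF : star F = F)
    {z : ℂ} (hz : HasTrace (G * (σ * σ) * star G * F) z) :
    z = vectorFunctional (fun i => σ (b i)) hv (star G * F * G) := by
  obtain ⟨z', h1, h2⟩ := b.exists_hasSum_inner_adjoint (S := F * G * σ) (T := G * σ)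
    (summable_norm_apply_sq hv (F * G)) (summable_norm_apply_sq hv G)
  have e1 : z = z' := by
    refine (hz ι b).unique ?_
    convert h2 using 2 with i
    rw [ContinuousLinearMap.adjoint_inner_left, ← ContinuousLinearMap.star_eq_adjoint]
    rw [star_mul, star_mul, hσ, hF]
    rfl
  have e2 : vectorFunctional (fun i => σ (b i)) hv (star G * F * G) = z' := by
    refine (hasSum_vectorFunctional hv _).unique ?_
    convert h1 using 2 with i
    have h3 : star (F * G) = star G * F := by rw [star_mul, hF]
    rw [← h3]
    exact ContinuousLinearMap.adjoint_inner_right (F * G) _ _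
  rw [e1, e2]

theorem HasSum.mem_of_isClosed_submodule {ι S E : Type*} [Semiring S] [AddCommMonoid E] [Module S E]
    [TopologicalSpace E] {C : Submodule S E} (hC : IsClosed (C : Set E)) {f : ι → E} {x : E}
    (hf : HasSum f x) (h : ∀ i, f i ∈ C) : x ∈ C :=
  hC.mem_of_tendsto hf (Filter.Eventually.of_forall fun _ => sum_mem fun i _ => h i)

variable {A X N m : ℕ} {ε : ℝ} {t : Fin N → ℝ} {E : Fin m → ℝ} {Eplus : ℝ}

theorem softSpectralDatasets_subset_image (hE : ∀ k, 0 ≤ E k ∧ E k < Eplus) :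
    softSpectralDatasets A X E Eplus ε t ⊆ certifiedDataset E t '' certificates A X m ε t := by
  rintro P ⟨R, hspec, ⟨w, hw, hwε⟩, hP⟩
  obtain ⟨σ, hσ, hσσ⟩ := exists_isSelfAdjoint_mul_self_eq R.ρ_pos
  obtain ⟨S, b, -⟩ := exists_hilbertBasis ℂ R.𝓗
  have hv1 : HasSum (fun i => ‖σ (b i)‖ ^ 2) 1 := by
    have h := (R.ρ_trace S b).mapL Complex.reCLM
    simp only [Complex.reCLM_apply, Complex.one_re] at h
    convert h using 2 with i
    rw [← hσσ]
    have : ⟪b i, (σ * σ) (b i)⟫_ℂ = ⟪σ (b i), σ (b i)⟫_ℂ := by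
      nth_rewrite 1 [← hσ]
      exact ContinuousLinearMap.adjoint_inner_right σ _ _
    rw [this]
    exact (inner_self_eq_norm_sq (𝕜 := ℂ) _).symm
  have hv := hv1.summable
  set τ := vectorFunctional (fun i => σ (b i)) hv with hτ
  have hτ1 : τ 1 = 1 := by
    refine (hasSum_vectorFunctional hv 1).unique ?_
    have h := hv1.mapL Complex.ofRealCLM
    simp only [Complex.ofRealCLM_apply, Complex.ofReal_one] at h
    convert h using 2 with i
    rw [one_apply_eq_self, inner_self_eq_norm_sq_to_K]
    simp
  have hI : MeasurableSet (Set.Ici Eplus) := measurableSet_Ici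
  have hB := measurableSet_levelSet E
  have hproj_star : ∀ B, MeasurableSet B → star (R.Q.proj B) = R.Q.proj B := fun B hB =>
    (R.Q.isStarProjection B hB).isSelfAdjoint
  have hproj_idem : ∀ B, MeasurableSet B → R.Q.proj B * R.Q.proj B = R.Q.proj B := fun B hB =>
    (R.Q.isStarProjection B hB).isIdempotentElem
  have hproj_nonneg : ∀ B, MeasurableSet B → 0 ≤ τ (R.Q.proj B) := fun B hB =>
    vectorFunctional_nonneg hv
      ((ContinuousLinearMap.nonneg_iff_isPositive _).1 (R.Q.isStarProjection B hB).nonneg)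
  have hproj_re : ∀ B, MeasurableSet B → ((τ (R.Q.proj B)).re : ℂ) = τ (R.Q.proj B) :=
    fun B hB => (Complex.eq_re_of_ofReal_le (r := 0) (by simpa using hproj_nonneg B hB)).symm
  have hBI : ∀ k, Disjoint (levelSet E k) (Set.Ici Eplus) := fun k => by
    rw [Set.disjoint_left]
    rintro e ⟨rfl, -⟩ h
    exact absurd (hE k).2 (not_lt.2 h)
  have hone : ∑ k, R.Q.proj (levelSet E k) + R.Q.proj (Set.Ici Eplus) = 1 := by
    refine ProjValuedMeasure.sum_proj_add_proj_eq_one hB (fun k l h => disjoint_levelSet E h) hI hBI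
      fun ψ => ?_
    rw [iUnion_levelSet]
    exact R.Q_spec.scalarMeasure_compl_eq_zero R.H_selfAdjoint R.H_nonneg hspec ψ
  have hwτ : (w : ℂ) = τ (R.Q.proj (Set.Ici Eplus)) := by
    have h := HasTrace.eq_vectorFunctional (G := 1) (F := R.Q.proj (Set.Ici Eplus)) (z := w) hσ hv
      (hproj_star _ hI) (by simpa [hσσ] using hw)
    simpa using h
  let V : Fin m ⊕ Fin N → R.𝓗 →L[ℂ] R.𝓗 :=
    Sum.elim (fun k => R.Q.proj (levelSet E k)) (fun j => R.U (t j) * R.Q.proj (Set.Ici Eplus))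
  have hV : ∀ j, ∑ u, probeVector E t j u • V u = R.U (t j) := by
    intro j
    rw [Fintype.sum_sum_type]
    have h1 : ∑ l, probeVector E t j (Sum.inr l) • V (Sum.inr l) =
        R.U (t j) * R.Q.proj (Set.Ici Eplus) := by
      rw [Finset.sum_eq_single j] <;> simp +contextual [probeVector, V]
    have h2 : ∀ k, probeVector E t j (Sum.inl k) • V (Sum.inl k) =
        R.U (t j) * R.Q.proj (levelSet E k) := fun k =>
      (ProjValuedMeasure.evolution_mul_proj_of_subset R.U_spec (t j) (hB k)
        (levelSet_subset E k)).symm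
    rw [h1, Finset.sum_congr rfl fun k _ => h2 k, ← Finset.mul_sum, ← mul_add, hone, mul_one]
  -- A repeated energy has an empty level set at its later indices, so these receive weight zero.
  let p : Fin (m + 1) → ℝ := Fin.snoc (fun k => (τ (R.Q.proj (levelSet E k))).re)
    (τ (R.Q.proj (Set.Ici Eplus))).re
  have hp_last : p (Fin.last m) = (τ (R.Q.proj (Set.Ici Eplus))).re := Fin.snoc_last _ _
  have hp_cast : ∀ k : Fin m, p k.castSucc = (τ (R.Q.proj (levelSet E k))).re :=
    fun k => Fin.snoc_castSucc _ _ _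
  let γ : Matrix (Fin N) (Fin N) ℂ :=
    Matrix.of fun j k => τ (R.U (t k - t j) * R.Q.proj (Set.Ici Eplus))
  -- Each vector `σ (b i)` contributes the decay matrix of its scalar measure on `[Eplus, ∞)`; a
  -- closed cone contains the sum of the series.
  have hγ : γ ∈ decayMatrices t := by
    rw [← decayMatricesOn_Ici t Eplus, decayMatricesOn_eq_closure hI]
    have hsum : HasSum (fun i => (fun j k => ⟪σ (b i), (R.U (t k - t j) *
        R.Q.proj (Set.Ici Eplus)) (σ (b i))⟫_ℂ : Fin N → Fin N → ℂ)) γ :=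
      Pi.hasSum.2 fun j => Pi.hasSum.2 fun k => hasSum_vectorFunctional hv _
    refine HasSum.mem_of_isClosed_submodule
      (C := (phaseCone (Set.Ici Eplus) t).topologicalClosure) isClosed_closure hsum fun i => ?_
    have hmem := integral_phaseMatrix_mem_closure hI t (R.Q.scalarMeasure (σ (b i)))
    have heq : (fun j k => ⟪σ (b i), (R.U (t k - t j) * R.Q.proj (Set.Ici Eplus)) (σ (b i))⟫_ℂ) =
        ∫ e in Set.Ici Eplus, phaseMatrix t e ∂(R.Q.scalarMeasure (σ (b i))) := ?_
    · rw [heq]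
      exact hmem
    funext j k
    rw [integral_phaseMatrix_apply,
      (R.U_spec (t k - t j)).mul_proj (ProjValuedMeasure.isBddMeasurable_phase _) hI,
      ← MeasureTheory.integral_indicator hI]
    congr 1
    funext e
    by_cases h : e ∈ Set.Ici Eplus
    · simp [h, phaseMatrix]
    · simp [h]
  refine ⟨(p, γ, fun a x => compressionMatrix hv V (R.M a x)), ⟨?_, ?_, hγ, ?_, ?_, ?_, ?_⟩, ?_⟩
  · intro k
    refine Fin.lastCases ?_ (fun k => ?_) k
    · change 0 ≤ p (Fin.last m)
      rw [hp_last]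
      exact (Complex.nonneg_iff.1 (hproj_nonneg _ hI)).1
    · change 0 ≤ p k.castSucc
      rw [hp_cast]
      exact (Complex.nonneg_iff.1 (hproj_nonneg _ (hB k))).1
  · change ∑ k, p k = 1
    rw [Fin.sum_univ_castSucc, hp_last, Finset.sum_congr rfl fun k _ => hp_cast k,
      ← Complex.re_sum, ← map_sum, ← Complex.add_re, ← map_add, hone, hτ1, Complex.one_re]
  · change p (Fin.last m) ≤ ε
    rw [hp_last, ← hwτ, Complex.ofReal_re]
    exact hwε
  · exact fun a x => posSemidef_compressionMatrix hv V (R.M_pos a x)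
  · intro x
    change ∑ a, compressionMatrix hv V (R.M a x) = _
    rw [sum_compressionMatrix hv V _ (R.M_sum x)]
    -- The evolution commutes with spectral projections, and those of disjoint sets multiply to
    -- zero.
    have hcross : ∀ (k : Fin m) (j : Fin N), star (V (Sum.inl k)) * V (Sum.inr j) = 0 := by
      intro k j
      change star (R.Q.proj (levelSet E k)) * (R.U (t j) * R.Q.proj (Set.Ici Eplus)) = 0
      rw [hproj_star _ (hB k), (R.U_spec (t j)).commute_proj
        (ProjValuedMeasure.isBddMeasurable_phase _) hI, ← mul_assoc, ← R.Q.proj_inter _ _ (hB k) hI,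
        (hBI k).inter_eq, R.Q.proj_empty, zero_mul]
    ext u u'
    rw [Matrix.of_apply]
    rcases u with k | j <;> rcases u' with l | j'
    · change τ (star (R.Q.proj (levelSet E k)) * R.Q.proj (levelSet E l)) = _
      rw [Matrix.fromBlocks_apply₁₁, hproj_star _ (hB k)]
      by_cases h : k = l
      · subst h
        rw [Matrix.diagonal_apply_eq, hproj_idem _ (hB k)]
        change _ = ((p k.castSucc : ℝ) : ℂ)
        rw [hp_cast, hproj_re _ (hB k)]
      · rw [Matrix.diagonal_apply_ne _ h, ← R.Q.proj_inter _ _ (hB k) (hB l),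
          (disjoint_levelSet E h).inter_eq, R.Q.proj_empty, map_zero]
    · rw [hcross, map_zero, Matrix.fromBlocks_apply₁₂, Matrix.zero_apply]
    · have h := congrArg star (hcross l j)
      rw [star_mul, star_star, star_zero] at h
      rw [h, map_zero, Matrix.fromBlocks_apply₂₁, Matrix.zero_apply]
    · rw [Matrix.fromBlocks_apply₂₂]
      change τ (star (R.U (t j) * _) * (R.U (t j') * _)) = _
      rw [ProjValuedMeasure.star_evolution_mul_proj R.U_spec _ _ hI]
      rfl
  · intro j
    change τ (R.U (t j - t j) * R.Q.proj (Set.Ici Eplus)) = (p (Fin.last m) : ℂ)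
    rw [sub_self, ProjValuedMeasure.evolution_zero R.U_spec, one_mul, hp_last, hproj_re _ hI]
  · funext a x j
    have h := HasTrace.eq_vectorFunctional (G := R.U (t j)) (F := R.M a x) (z := (P a x j : ℂ))
      hσ hv (R.M_pos a x).isSelfAdjoint (by
        rw [hσσ, ProjValuedMeasure.star_evolution R.U_spec]
        exact hP a x j)
    change (star (probeVector E t j) ⬝ᵥ (compressionMatrix hv V (R.M a x) *ᵥ
      probeVector E t j)).re = P a x j
    rw [dotProduct_compressionMatrix, hV, ← h, Complex.ofReal_re]

end Forward

/-! ### Traces of rank-one operators. -/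

section RankOne

variable {𝓗 : Type} [NormedAddCommGroup 𝓗] [InnerProductSpace ℂ 𝓗]

theorem hasTrace_of_apply_eq {T : 𝓗 →L[ℂ] 𝓗} {φ ψ : 𝓗} (hT : ∀ x, T x = ⟪φ, x⟫_ℂ • ψ) :
    HasTrace T ⟪φ, ψ⟫_ℂ := by
  intro ι b
  simpa only [hT, inner_smul_right] using b.hasSum_inner_mul_inner φ ψ

end RankOne

/-! ### Finite-dimensional realizations with diagonal Hamiltonian. -/

section DiagonalRealization

open MeasureTheory

variable {n : Type} [Fintype n] [DecidableEq n]

/-- Multiplication of the coordinates by `f`. -/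
def diagonalOp (f : n → ℂ) : EuclideanSpace ℂ n →L[ℂ] EuclideanSpace ℂ n :=
  Matrix.toEuclideanCLM (n := n) (𝕜 := ℂ) (Matrix.diagonal f)

theorem diagonalOp_apply (f : n → ℂ) (ψ : EuclideanSpace ℂ n) (i : n) :
    diagonalOp f ψ i = f i * ψ i := by
  rw [diagonalOp, Matrix.ofLp_toEuclideanCLM, Matrix.mulVec_diagonal]

theorem diagonalOp_mul (f g : n → ℂ) : diagonalOp f * diagonalOp g = diagonalOp (f * g) := by
  rw [diagonalOp, diagonalOp, ← map_mul, Matrix.diagonal_mul_diagonal]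
  rfl

theorem diagonalOp_one : diagonalOp (1 : n → ℂ) = 1 := by
  rw [diagonalOp, Matrix.diagonal_one', map_one]

theorem star_diagonalOp (f : n → ℂ) : star (diagonalOp f) = diagonalOp (star f) := by
  rw [diagonalOp, ← map_star, Matrix.star_eq_conjTranspose, Matrix.diagonal_conjTranspose]
  rfl

theorem inner_diagonalOp (f : n → ℂ) (ψ : EuclideanSpace ℂ n) :
    ⟪ψ, diagonalOp f ψ⟫_ℂ = ∑ i, ((‖ψ i‖ ^ 2 : ℝ) : ℂ) * f i := by
  rw [PiLp.inner_apply]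
  refine Finset.sum_congr rfl fun i _ => ?_
  rw [diagonalOp_apply, RCLike.inner_apply, ← Complex.normSq_eq_norm_sq,
    Complex.normSq_eq_conj_mul_self]
  ring

/-- The spectral measure of a diagonal operator. -/
def diagonalPVM (d : n → ℝ) : ProjValuedMeasure (EuclideanSpace ℂ n) where
  proj B := diagonalOp fun i => B.indicator 1 (d i)
  isStarProjection B _ := by
    constructor
    · rw [IsIdempotentElem, diagonalOp_mul]
      congr 1
      funext i
      by_cases h : d i ∈ B <;> simp [h]
    · rw [IsSelfAdjoint, star_diagonalOp]
      congr 1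
      funext i
      by_cases h : d i ∈ B <;> simp [h]
  proj_univ := by
    simp only [Set.indicator_univ, Pi.one_apply]
    exact diagonalOp_one
  proj_inter B C _ _ := by
    rw [diagonalOp_mul]
    congr 1
    funext i
    rw [Set.inter_indicator_one]
    rfl
  hasSum_iUnion f _ hd ψ := by
    have h : HasSum (fun k => WithLp.ofLp (diagonalOp (fun i => (f k).indicator 1 (d i)) ψ))
        (WithLp.ofLp (diagonalOp (fun i => (⋃ k, f k).indicator 1 (d i)) ψ)) := by
      refine Pi.hasSum.2 fun i => ?_
      simp only [diagonalOp_apply]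
      refine HasSum.mul_right _ ?_
      by_cases hi : d i ∈ ⋃ k, f k
      · obtain ⟨k, hk⟩ := Set.mem_iUnion.1 hi
        rw [Set.indicator_of_mem hi, Pi.one_apply]
        have hfun : (fun l => (f l).indicator (1 : ℝ → ℂ) (d i)) =
            fun l => if l = k then 1 else 0 := by
          funext l
          by_cases hl : l = k
          · subst hl
            simp [hk]
          · have : d i ∉ f l := fun h => Set.disjoint_left.1 (hd hl) h hk
            simp [hl, this]
        rw [hfun]
        exact hasSum_ite_eq k 1
      · rw [Set.indicator_of_notMem hi]
        have hk : ∀ k, d i ∉ f k := fun k h => hi (Set.mem_iUnion.2 ⟨k, h⟩)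
        simp [hk]
    exact h.mapL ((EuclideanSpace.equiv n ℂ).symm : (n → ℂ) →L[ℂ] EuclideanSpace ℂ n)

theorem scalarMeasure_diagonalPVM (d : n → ℝ) (ψ : EuclideanSpace ℂ n) :
    (diagonalPVM d).scalarMeasure ψ = ∑ i, ENNReal.ofReal (‖ψ i‖ ^ 2) • Measure.dirac (d i) := by
  ext B hB
  rw [ProjValuedMeasure.scalarMeasure, Measure.ofMeasurable_apply _ hB, diagonalPVM,
    inner_diagonalOp, Complex.re_sum, Measure.coe_finsetSum, Finset.sum_apply,
    ENNReal.ofReal_sum_of_nonneg]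
  · refine Finset.sum_congr rfl fun i _ => ?_
    rw [Measure.smul_apply, Measure.dirac_apply' _ hB]
    by_cases h : d i ∈ B <;> simp [h, -Complex.ofReal_pow]
  · intro i _
    by_cases h : d i ∈ B <;> simp [h, -Complex.ofReal_pow]

theorem integrable_diagonalPVM {F : Type*} [NormedAddCommGroup F] (d : n → ℝ)
    (ψ : EuclideanSpace ℂ n) (f : ℝ → F) : Integrable f ((diagonalPVM d).scalarMeasure ψ) := by
  rw [scalarMeasure_diagonalPVM, integrable_finsetSum_measure]
  exact fun i _ => (integrable_dirac (by simp)).smul_measure ENNReal.ofReal_ne_top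

theorem integral_diagonalPVM {F : Type*} [NormedAddCommGroup F] [NormedSpace ℝ F] [CompleteSpace F]
    (d : n → ℝ) (ψ : EuclideanSpace ℂ n) (f : ℝ → F) :
    ∫ e, f e ∂((diagonalPVM d).scalarMeasure ψ) = ∑ i, (‖ψ i‖ ^ 2) • f (d i) := by
  rw [scalarMeasure_diagonalPVM, integral_finsetSum_measure]
  · refine Finset.sum_congr rfl fun i _ => ?_
    rw [integral_smul_measure, integral_dirac, ENNReal.toReal_ofReal (by positivity)]
  · exact fun i _ => (integrable_dirac (by simp)).smul_measure ENNReal.ofReal_ne_top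

theorem isIntegral_diagonalPVM (d : n → ℝ) (f : ℝ → ℂ) :
    (diagonalPVM d).IsIntegral f (diagonalOp fun i => f (d i)) := by
  intro ψ
  rw [integral_diagonalPVM, inner_diagonalOp]
  simp only [Complex.real_smul]

/-- The diagonal operator as an everywhere defined partial operator. -/
def diagonalHamiltonian (d : n → ℝ) : EuclideanSpace ℂ n →ₗ.[ℂ] EuclideanSpace ℂ n :=
  (diagonalOp fun i => (d i : ℂ)).toPMap ⊤

theorem diagonalHamiltonian_apply (d : n → ℝ) (ψ : (diagonalHamiltonian d).domain) :
    diagonalHamiltonian d ψ = diagonalOp (fun i => (d i : ℂ)) (ψ : EuclideanSpace ℂ n) := rfl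

theorem isSelfAdjoint_diagonalHamiltonian (d : n → ℝ) : IsSelfAdjoint (diagonalHamiltonian d) := by
  rw [LinearPMap.isSelfAdjoint_def, diagonalHamiltonian,
    ContinuousLinearMap.toPMap_adjoint_eq_adjoint_toPMap_of_dense _ (by simp),
    ← ContinuousLinearMap.star_eq_adjoint, star_diagonalOp]
  congr 3
  funext i
  simp

theorem isSpectralMeasureOf_diagonalPVM (d : n → ℝ) :
    (diagonalPVM d).IsSpectralMeasureOf (diagonalHamiltonian d) := by
  refine ⟨fun ψ => ⟨fun _ => integrable_diagonalPVM _ _ _, fun _ => Submodule.mem_top⟩, fun ψ => ?_⟩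
  rw [diagonalHamiltonian_apply, inner_diagonalOp, integral_diagonalPVM, Complex.ofReal_sum]
  simp only [smul_eq_mul, Complex.ofReal_mul]

theorem realSpectrum_diagonalHamiltonian (d : n → ℝ) :
    realSpectrum (diagonalHamiltonian d) = Set.range d := by
  ext e
  rw [realSpectrum, Set.mem_ofPred_eq, not_iff_comm]
  constructor
  · intro he
    have hne : ∀ i, (d i : ℂ) - e ≠ 0 := fun i h => he ⟨i, by
      rw [sub_eq_zero] at h
      exact_mod_cast h⟩
    refine ⟨diagonalOp fun i => ((d i : ℂ) - e)⁻¹, fun y => ⟨Submodule.mem_top, ?_⟩, fun y => ?_⟩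
    · rw [diagonalHamiltonian_apply]
      ext i
      simp only [PiLp.sub_apply, PiLp.smul_apply, diagonalOp_apply, smul_eq_mul]
      field_simp [hne i]
    · rw [diagonalHamiltonian_apply]
      ext i
      simp only [PiLp.sub_apply, PiLp.smul_apply, diagonalOp_apply, smul_eq_mul]
      field_simp [hne i]
  -- The `i`-th basis vector is annihilated by `H - d i`, so no left inverse exists.
  · rintro ⟨R, -, hR⟩ ⟨i, rfl⟩
    have h := hR ⟨EuclideanSpace.single i 1, Submodule.mem_top⟩
    rw [diagonalHamiltonian_apply] at h
    have h0 : diagonalOp (fun i => (d i : ℂ)) (EuclideanSpace.single i 1) -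
        (d i : ℂ) • EuclideanSpace.single i (1 : ℂ) = 0 := by
      ext k
      simp only [PiLp.sub_apply, PiLp.smul_apply, diagonalOp_apply, smul_eq_mul, PiLp.zero_apply,
        PiLp.single_apply]
      by_cases hk : k = i <;> simp [hk]
    simp only [h0, map_zero] at h
    have := congrArg (fun v : EuclideanSpace ℂ n => v i) h
    simp at this

theorem isPositive_toEuclideanCLM {M : Matrix n n ℂ} (hM : M.PosSemidef) :
    (Matrix.toEuclideanCLM (n := n) (𝕜 := ℂ) M).IsPositive := by
  rw [← ContinuousLinearMap.isPositive_toLinearMap_iff]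
  exact Matrix.isPositive_toEuclideanLin_iff.2 hM

/-- A pure state, a diagonal Hamiltonian and a POVM on `ℂ^n` form a quantum realization. -/
theorem exists_diagonal_realization {A X : ℕ} {d : n → ℝ} (hd : ∀ i, 0 ≤ d i)
    {ψ : EuclideanSpace ℂ n} (hψ : ‖ψ‖ = 1) {F : Fin A → Fin X → Matrix n n ℂ}
    (hF : ∀ a x, (F a x).PosSemidef) (hsum : ∀ x, ∑ a, F a x = 1) :
    ∃ R : Realization A X, realSpectrum R.H = Set.range d ∧
      (∀ B ε, ∑ i, B.indicator (fun _ => ‖ψ i‖ ^ 2) (d i) ≤ ε → R.EnergyWeightLE B ε) ∧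
      ∀ a x (s q : ℝ) (w : n → ℂ), (∀ i, w i = Complex.exp (-Complex.I * d i * s) * ψ i) →
        (q : ℂ) = star w ⬝ᵥ (F a x *ᵥ w) → R.Yields a x s q := by
  let U : ℝ → EuclideanSpace ℂ n →L[ℂ] EuclideanSpace ℂ n :=
    fun s => diagonalOp fun i => Complex.exp (-Complex.I * d i * s)
  have hU : ∀ s : ℝ, (diagonalPVM d).IsIntegral (fun e => Complex.exp (-Complex.I * e * s)) (U s) :=
    fun s => isIntegral_diagonalPVM d fun e => Complex.exp (-Complex.I * e * s)
  let R : Realization A X :=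
    { 𝓗 := EuclideanSpace ℂ n
      ρ := InnerProductSpace.rankOne ℂ ψ ψ
      ρ_pos := InnerProductSpace.isPositive_rankOne_self ψ
      ρ_trace := by
        have h := hasTrace_of_apply_eq (T := InnerProductSpace.rankOne ℂ ψ ψ) (φ := ψ) (ψ := ψ)
          (fun x => rfl)
        rwa [inner_self_eq_norm_sq_to_K, hψ, RCLike.ofReal_one, one_pow] at h
      H := diagonalHamiltonian d
      H_selfAdjoint := isSelfAdjoint_diagonalHamiltonian d
      H_nonneg := fun φ => by
        rw [diagonalHamiltonian_apply, inner_diagonalOp, Complex.re_sum]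
        refine Finset.sum_nonneg fun i _ => ?_
        rw [← Complex.ofReal_mul, Complex.ofReal_re]
        exact mul_nonneg (by positivity) (hd i)
      Q := diagonalPVM d
      Q_spec := isSpectralMeasureOf_diagonalPVM d
      U := U
      U_spec := hU
      M := fun a x => Matrix.toEuclideanCLM (n := n) (𝕜 := ℂ) (F a x)
      M_pos := fun a x => isPositive_toEuclideanCLM (hF a x)
      M_sum := fun x => by rw [← map_sum, hsum, map_one] }
  refine ⟨R, realSpectrum_diagonalHamiltonian d, fun B ε hε => ⟨_, ?_, hε⟩, ?_⟩
  · let T : EuclideanSpace ℂ n →L[ℂ] EuclideanSpace ℂ n := diagonalOp fun i => B.indicator 1 (d i)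
    have hT : star T = T := by
      rw [star_diagonalOp]
      congr 1
      funext i
      by_cases h : d i ∈ B <;> simp [h]
    have h := hasTrace_of_apply_eq (T := InnerProductSpace.rankOne ℂ ψ ψ * T) (φ := T ψ) (ψ := ψ)
      (fun x => by
        nth_rewrite 2 [← hT]
        rw [ContinuousLinearMap.star_eq_adjoint, ContinuousLinearMap.adjoint_inner_left]
        rfl)
    have hval : ⟪T ψ, ψ⟫_ℂ = ((∑ i, B.indicator (fun _ => ‖ψ i‖ ^ 2) (d i) : ℝ) : ℂ) := by
      nth_rewrite 1 [← hT]
      rw [ContinuousLinearMap.star_eq_adjoint, ContinuousLinearMap.adjoint_inner_left,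
        inner_diagonalOp, Complex.ofReal_sum]
      refine Finset.sum_congr rfl fun i _ => ?_
      by_cases h : d i ∈ B <;> simp [h]
    rw [hval] at h
    exact h
  · intro a x s q w hw hq
    let M := Matrix.toEuclideanCLM (n := n) (𝕜 := ℂ) (F a x)
    have hM : star M = M := (isPositive_toEuclideanCLM (hF a x)).isSelfAdjoint
    have hUs : star (U s) = U (-s) := ProjValuedMeasure.star_evolution hU s
    have h := hasTrace_of_apply_eq (T := U s * InnerProductSpace.rankOne ℂ ψ ψ * U (-s) * M)
      (φ := M (U s ψ)) (ψ := U s ψ) (fun y => by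
        have h1 : ⟪M (U s ψ), y⟫_ℂ = ⟪ψ, U (-s) (M y)⟫_ℂ := by
          rw [← hUs, ContinuousLinearMap.star_eq_adjoint, ContinuousLinearMap.adjoint_inner_right]
          nth_rewrite 1 [← hM]
          rw [ContinuousLinearMap.star_eq_adjoint, ContinuousLinearMap.adjoint_inner_left]
        rw [h1]
        exact map_smul (U s) _ _)
    have hval : ⟪M (U s ψ), U s ψ⟫_ℂ = (q : ℂ) := by
      nth_rewrite 1 [← hM]
      rw [ContinuousLinearMap.star_eq_adjoint, ContinuousLinearMap.adjoint_inner_left, hq,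
        EuclideanSpace.inner_eq_star_dotProduct, Matrix.ofLp_toEuclideanCLM, dotProduct_comm]
      have : WithLp.ofLp (U s ψ) = w := by
        funext i
        rw [hw, diagonalOp_apply]
      rw [this]
    rw [hval] at h
    exact h

end DiagonalRealization

/-! ### From certificates to limits of realizations. -/

section Backward

open Filter Topology

open scoped NNReal

variable {A X N m K : ℕ} {ε : ℝ} {t : Fin N → ℝ} {E : Fin m → ℝ} {Eplus : ℝ}

/-- The matrix whose columns are the low-energy components and the evolved high-energy component
of a pure state with energy distribution `(p, q)`. -/
def stateMatrix (p : Fin m → ℝ) (q : Fin K → ℝ≥0) (e : Fin K → ℝ) (t : Fin N → ℝ) :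
    Matrix (Fin m ⊕ Fin K) (Fin m ⊕ Fin N) ℂ :=
  Matrix.fromBlocks (Matrix.diagonal fun k => (√(p k) : ℂ)) 0 0
    (Matrix.of fun l j => (√(q l : ℝ) : ℂ) * Complex.exp (-Complex.I * e l * t j))

/-- This puts the block matrix of a finitely supported certificate in the form required by
`exists_povm_of_sum_eq`. -/
theorem conjTranspose_stateMatrix_mul_self {p : Fin m → ℝ} (hp : ∀ k, 0 ≤ p k) (q : Fin K → ℝ≥0)
    (e : Fin K → ℝ) (t : Fin N → ℝ) :
    (stateMatrix p q e t)ᴴ * stateMatrix p q e t =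
      Matrix.fromBlocks (Matrix.diagonal fun k => (p k : ℂ)) 0 0
        (∑ l, q l • phaseMatrix t (e l) : Fin N → Fin N → ℂ) := by
  rw [stateMatrix, Matrix.fromBlocks_conjTranspose, Matrix.fromBlocks_multiply]
  simp only [Matrix.conjTranspose_zero, Matrix.mul_zero, Matrix.zero_mul, add_zero, zero_add]
  congr 1
  · rw [Matrix.diagonal_conjTranspose, Matrix.diagonal_mul_diagonal]
    congr 1
    funext k
    rw [Pi.star_apply, RCLike.star_def, Complex.conj_ofReal, ← Complex.ofReal_mul,
      Real.mul_self_sqrt (hp k)]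
  · ext j k
    rw [Matrix.mul_apply]
    simp only [Finset.sum_apply, Pi.smul_apply]
    refine Finset.sum_congr rfl fun l _ => ?_
    rw [Matrix.conjTranspose_apply, Matrix.of_apply, Matrix.of_apply, star_mul', RCLike.star_def,
      Complex.conj_ofReal, ProjValuedMeasure.conj_phase]
    rw [phaseMatrix, NNReal.smul_def, Complex.real_smul]
    have h1 : ((q l : ℝ) : ℂ) = (√(q l : ℝ) : ℂ) * (√(q l : ℝ) : ℂ) := by
      rw [← Complex.ofReal_mul, Real.mul_self_sqrt (q l).coe_nonneg]
    have h2 : Complex.exp (-Complex.I * e l * (t k - t j)) =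
        Complex.exp (-Complex.I * e l * (-t j : ℝ)) * Complex.exp (-Complex.I * e l * t k) := by
      rw [← Complex.exp_add]
      congr 1
      push_cast
      ring
    rw [h1, h2]
    ring

/-- The right side is the `u`-th amplitude at time `t j` of the pure state with real amplitudes
`√p`, `√q`, so quadratic forms in the probe vector become measurements on that state. -/
theorem stateMatrix_mulVec_probeVector (p : Fin m → ℝ) (q : Fin K → ℝ≥0) (e : Fin K → ℝ)
    (j : Fin N) (u : Fin m ⊕ Fin K) :
    (stateMatrix p q e t *ᵥ probeVector E t j) u =
      Complex.exp (-Complex.I * (Sum.elim E e u : ℝ) * t j) *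
        (Sum.elim (fun k => √(p k)) (fun l => √(q l : ℝ)) u : ℝ) := by
  rw [stateMatrix, probeVector, Matrix.fromBlocks_mulVec]
  rcases u with k | l
  · simp [Matrix.mulVec_diagonal, mul_comm]
  · simp [mul_comm]

theorem certifiedDataset_apply {c : (Fin (m + 1) → ℝ) × Matrix (Fin N) (Fin N) ℂ ×
      (Fin A → Fin X → Matrix (Fin m ⊕ Fin N) (Fin m ⊕ Fin N) ℂ)} {a : Fin A} {x : Fin X}
    (hM : (c.2.2 a x).PosSemidef) (j : Fin N) : (certifiedDataset E t c a x j : ℂ) =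
      star (probeVector E t j) ⬝ᵥ (c.2.2 a x *ᵥ probeVector E t j) :=
  (Complex.eq_re_of_ofReal_le (r := 0) (by simpa using hM.dotProduct_mulVec_nonneg _)).symm

/-- Certificates with a finitely supported high-energy distribution come from realizations. -/
theorem certifiedDataset_mem_softSpectralDatasets (hA : 0 < A)
    (hE : ∀ k, 0 ≤ E k ∧ E k < Eplus) {p : Fin (m + 1) → ℝ} (hp : ∀ k, 0 ≤ p k)
    (hp1 : ∑ k, p k = 1) (hpε : p (Fin.last m) ≤ ε) {q : Fin K → ℝ≥0}
    (hq : ∑ l, (q l : ℝ) = p (Fin.last m)) {e : Fin K → ℝ} (he : ∀ l, e l ∈ Set.Ici (max Eplus 0))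
    {γ : Matrix (Fin N) (Fin N) ℂ} {M : Fin A → Fin X → Matrix (Fin m ⊕ Fin N) (Fin m ⊕ Fin N) ℂ}
    (hM : ∀ a x, (M a x).PosSemidef)
    (hsum : ∀ x, ∑ a, M a x = Matrix.fromBlocks
      (Matrix.diagonal fun k : Fin m => (p k.castSucc : ℂ)) 0 0
        (∑ l, q l • phaseMatrix t (e l) : Fin N → Fin N → ℂ)) :
    certifiedDataset E t (p, γ, M) ∈ softSpectralDatasets A X E Eplus ε t := by
  let W := stateMatrix (fun k : Fin m => p k.castSucc) q e t
  have hW : ∀ x, ∑ a, M a x = Wᴴ * W := fun x => by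
    rw [hsum x, conjTranspose_stateMatrix_mul_self fun k => hp _]
  choose F hF hF1 hFW using fun x => exists_povm_of_sum_eq hA W (fun a => M a x)
    (fun a => hM a x) (hW x)
  let ψ : EuclideanSpace ℂ (Fin m ⊕ Fin K) := WithLp.toLp 2 fun u =>
    ((Sum.elim (fun k : Fin m => √(p k.castSucc)) (fun l => √(q l : ℝ)) u : ℝ) : ℂ)
  have hψl : ∀ k, ‖ψ (Sum.inl k)‖ ^ 2 = p k.castSucc := fun k => by
    simp [ψ, Real.sq_sqrt (hp _)]
  have hψr : ∀ l, ‖ψ (Sum.inr l)‖ ^ 2 = q l := fun l => by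
    simp [ψ]
  have hψ : ‖ψ‖ = 1 := by
    have h : ‖ψ‖ ^ 2 = 1 := by
      rw [EuclideanSpace.norm_sq_eq, Fintype.sum_sum_type]
      simp only [hψl, hψr]
      rw [hq, ← Fin.sum_univ_castSucc, hp1]
    exact (pow_eq_one_iff_of_nonneg (norm_nonneg _) two_ne_zero).1 h
  have hd : ∀ u, 0 ≤ Sum.elim E e u := by
    rintro (k | l)
    · exact (hE k).1
    · exact (le_max_right _ _).trans (he l)
  obtain ⟨R, hspec, hweight, hyield⟩ := exists_diagonal_realization hd hψ
    (F := fun a x => F x a) (fun a x => hF x a) hF1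
  refine ⟨R, ?_, hweight _ _ ?_, fun a x j => hyield a x (t j) _ (W *ᵥ probeVector E t j)
    (stateMatrix_mulVec_probeVector _ _ _ _) ?_⟩
  · rw [hspec]
    ext z
    constructor
    · rintro ⟨⟨k | l, rfl⟩, -, hz⟩
      · exact ⟨k, rfl⟩
      · exact absurd hz (not_lt.2 ((le_max_left _ _).trans (he l)))
    · rintro ⟨k, rfl⟩
      exact ⟨⟨Sum.inl k, rfl⟩, hE k⟩
  · rw [Fintype.sum_sum_type]
    have h1 : ∀ k : Fin m, (Set.Ici Eplus).indicator (fun _ => ‖ψ (Sum.inl k)‖ ^ 2)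
        (Sum.elim E e (Sum.inl k)) = 0 := fun k =>
      Set.indicator_of_notMem (not_le.2 (hE k).2) _
    have h2 : ∀ l : Fin K, (Set.Ici Eplus).indicator (fun _ => ‖ψ (Sum.inr l)‖ ^ 2)
        (Sum.elim E e (Sum.inr l)) = q l := fun l => by
      have hl : Sum.elim E e (Sum.inr l) ∈ Set.Ici Eplus :=
        (le_max_left Eplus 0).trans (Set.mem_Ici.1 (he l))
      rw [Set.indicator_of_mem hl, hψr]
    simp only [h1, h2, Finset.sum_const_zero, zero_add, hq]
    exact hpε
  · rw [certifiedDataset_apply (hM a x)]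
    change star (probeVector E t j) ⬝ᵥ (M a x *ᵥ probeVector E t j) = _
    rw [← hFW x a, Matrix.star_mulVec, ← Matrix.mulVec_mulVec, ← Matrix.mulVec_mulVec,
      Matrix.dotProduct_mulVec]

/-- Summed over outcomes, the data only see this value; normalization of the dataset thereby fixes
the diagonal of `γ`. -/
theorem dotProduct_fromBlocks_probeVector (p : Fin m → ℝ) (γ : Matrix (Fin N) (Fin N) ℂ)
    (j : Fin N) :
    star (probeVector E t j) ⬝ᵥ (Matrix.fromBlocks (Matrix.diagonal fun k => (p k : ℂ)) 0 0 γ *ᵥ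
      probeVector E t j) = ((∑ k, p k : ℝ) : ℂ) + γ j j := by
  rw [probeVector, Matrix.fromBlocks_mulVec, dotProduct, Fintype.sum_sum_type]
  congr 1
  · rw [Complex.ofReal_sum]
    refine Finset.sum_congr rfl fun k _ => ?_
    have h := norm_exp_phase (E k) (t j)
    have h2 : (starRingEnd ℂ) (Complex.exp (-Complex.I * E k * t j)) *
        Complex.exp (-Complex.I * E k * t j) = 1 := by
      rw [← Complex.normSq_eq_conj_mul_self, Complex.normSq_eq_norm_sq, h]
      simp
    simp only [Pi.star_apply, Sum.elim_inl, Function.comp_def, Matrix.zero_mulVec, add_zero,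
      Matrix.mulVec_diagonal, RCLike.star_def]
    linear_combination (p k : ℂ) * h2
  · simp [Function.comp_def, Pi.single_apply, apply_ite, Matrix.mulVec, dotProduct]

/-- Approximate `γ` by finite combinations `g' n` of point masses, rescaled to keep the weight `p
m`. Factoring the block matrix as `Sᴴ * S` extracts POVMs `F` from `M`; conjugating the same `F` by
the square roots for `g' n` gives certificates with exact sums that converge to `M`. -/
theorem mem_closure_of_certificate (hA : 0 < A) (hE : ∀ k, 0 ≤ E k ∧ E k < Eplus)
    {P : Fin A → Fin X → Fin N → ℝ} (hP : IsDataset P) {p : Fin (m + 1) → ℝ}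
    {γ : Matrix (Fin N) (Fin N) ℂ} {M : Fin A → Fin X → Matrix (Fin m ⊕ Fin N) (Fin m ⊕ Fin N) ℂ}
    (hp : ∀ k, 0 ≤ p k) (hp1 : ∑ k, p k = 1) (hγ : γ ∈ decayMatrices t)
    (hpε : p (Fin.last m) ≤ ε) (hM : ∀ a x, (M a x).PosSemidef)
    (hsum : ∀ x, ∑ a, M a x =
      Matrix.fromBlocks (Matrix.diagonal fun k : Fin m => (p k.castSucc : ℂ)) 0 0 γ)
    (hPM : ∀ a x j, (P a x j : ℂ) =
      star (probeVector E t j) ⬝ᵥ (M a x *ᵥ probeVector E t j)) :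
    P ∈ closure (softSpectralDatasets A X E Eplus ε t) := by
  have hPeq : certifiedDataset E t (p, γ, M) = P := by
    funext a x j
    have h := certifiedDataset_apply (E := E) (t := t) (c := (p, γ, M)) (hM a x) j
    rw [← hPM] at h
    exact_mod_cast h
  -- Without a setting or a time the data do not constrain `γ`, and one atom of weight `p m`
  -- replaces it.
  rcases isEmpty_or_nonempty (Fin X × Fin N) with hempty | ⟨x₀, j₀⟩
  · refine subset_closure ?_
    rw [← hPeq]
    refine certifiedDataset_mem_softSpectralDatasets (K := 1) hA hE hp hp1 hpε
      (q := fun _ => (p (Fin.last m)).toNNReal) (by simp [hp]) (e := fun _ => max Eplus 0)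
      (fun _ => Set.self_mem_Ici) hM fun x => ?_
    rw [hsum x]
    congr 1
    ext j
    exact (hempty.false (x, j)).elim
  have hdiag : ∀ j, γ j j = p (Fin.last m) := by
    intro j
    have h1 : ((∑ a, P a x₀ j : ℝ) : ℂ) = ((∑ k : Fin m, p k.castSucc : ℝ) : ℂ) + γ j j := by
      rw [← dotProduct_fromBlocks_probeVector (E := E) (t := t), ← hsum x₀, Matrix.sum_mulVec,
        dotProduct_sum, Complex.ofReal_sum]
      exact Finset.sum_congr rfl fun a _ => hPM a x₀ j
    rw [hP.2, ← hp1, Fin.sum_univ_castSucc, Complex.ofReal_add] at h1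
    exact (add_left_cancel h1).symm
  have hγ' : γ ∈ closure (phaseCone (Set.Ici (max Eplus 0)) t : Set (Fin N → Fin N → ℂ)) := by
    rw [← decayMatricesOn_eq_closure measurableSet_Ici, decayMatricesOn_Ici]
    exact hγ
  -- If `p m = 0`, the entry bound forces `γ = 0` and no atoms are needed. Otherwise the weights can
  -- be rescaled by a factor tending to `1`.
  rcases (hp (Fin.last m)).eq_or_lt with h0 | hpos
  · refine subset_closure ?_
    rw [← hPeq]
    refine certifiedDataset_mem_softSpectralDatasets (K := 0) hA hE hp hp1 hpε
      (q := Fin.elim0) (by simpa using h0) (e := Fin.elim0) (fun l => l.elim0) hM fun x => ?_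
    rw [hsum x]
    congr 1
    ext j k
    have h := norm_apply_le_of_mem_closure hγ' j k
    rw [hdiag, ← h0] at h
    simpa using h
  obtain ⟨g, hg, hlim⟩ := (mem_closure_iff_seq_limit (X := Fin N → Fin N → ℂ)).1 hγ'
  choose K c e he hge using fun n => mem_phaseCone.1 (hg n)
  have hs : Tendsto (fun n => ∑ l, (c n l : ℝ)) atTop (𝓝 (p (Fin.last m))) := by
    have h1 : Tendsto (fun n => (g n j₀ j₀).re) atTop (𝓝 (γ j₀ j₀).re) :=
      (Complex.continuous_re.tendsto _).comp ((tendsto_pi_nhds.1 ((tendsto_pi_nhds.1 hlim) j₀)) j₀)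
    rw [hdiag, Complex.ofReal_re] at h1
    convert h1 using 2 with n
    rw [hge n]
    simp [phaseMatrix_diag, NNReal.smul_def]
  let s : ℕ → ℝ≥0 := fun n => (p (Fin.last m)).toNNReal / ∑ l, c n l
  have hs1 : Tendsto (fun n => (s n : ℝ)) atTop (𝓝 1) := by
    have h := (tendsto_const_nhds (x := p (Fin.last m))).div hs hpos.ne'
    rw [div_self hpos.ne'] at h
    convert h using 2 with n
    simp [s, hp]
  let g' : ℕ → Matrix (Fin N) (Fin N) ℂ := fun n =>
    (∑ l, (s n * c n l) • phaseMatrix t (e n l) : Fin N → Fin N → ℂ)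
  have hg' : Tendsto g' atTop (𝓝 γ) := by
    have hone : (1 : ℝ) • (show Fin N → Fin N → ℂ from γ) = γ := one_smul ℝ _
    have h := hs1.smul hlim
    rw [hone] at h
    have hfun : (fun n => (s n : ℝ) • g n) = g' := by
      funext n
      rw [hge n, Finset.smul_sum]
      exact Finset.sum_congr rfl fun l _ => (mul_smul (s n) (c n l) (phaseMatrix t (e n l))).symm
    rw [hfun] at h
    exact h
  let D : Matrix (Fin N) (Fin N) ℂ → Matrix (Fin m ⊕ Fin N) (Fin m ⊕ Fin N) ℂ := fun γ =>
    Matrix.fromBlocks (Matrix.diagonal fun k : Fin m => (p k.castSucc : ℂ)) 0 0 γ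
  have hDcont : Continuous D :=
    Continuous.matrix_fromBlocks continuous_const continuous_const continuous_const continuous_id
  have hD : (D γ).PosSemidef := by
    rw [show D γ = _ from (hsum x₀).symm]
    exact Matrix.posSemidef_sum _ fun a _ => hM a x₀
  have hDn : ∀ n, (D (g' n)).PosSemidef := fun n => by
    rw [show D (g' n) = _ from (conjTranspose_stateMatrix_mul_self (fun k => hp _) _ _ _).symm]
    exact Matrix.posSemidef_conjTranspose_mul_self _
  obtain ⟨S, hScont, hS⟩ := Matrix.exists_continuousOn_sqrt (n := Fin m ⊕ Fin N)
  have hSlim : Tendsto (fun n => S (D (g' n))) atTop (𝓝 (S (D γ))) :=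
    (hScont _ hD).tendsto.comp
      (tendsto_nhdsWithin_iff.2 ⟨(hDcont.tendsto γ).comp hg', Eventually.of_forall hDn⟩)
  choose F hF hF1 hFW using fun x => exists_povm_of_sum_eq hA (S (D γ)) (fun a => M a x)
    (fun a => hM a x) ((hsum x).trans (hS _ hD).symm)
  let Mn : ℕ → Fin A → Fin X → Matrix (Fin m ⊕ Fin N) (Fin m ⊕ Fin N) ℂ := fun n a x =>
    (S (D (g' n)))ᴴ * F x a * S (D (g' n))
  have hMn : Tendsto Mn atTop (𝓝 M) := by
    refine tendsto_pi_nhds.2 fun a => tendsto_pi_nhds.2 fun x => ?_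
    rw [← hFW x a]
    exact (((continuous_id.matrix_conjTranspose.tendsto _).comp hSlim).mul_const _).mul hSlim
  have hPlim : Tendsto (fun n => certifiedDataset E t (p, γ, Mn n)) atTop (𝓝 P) := by
    rw [← hPeq]
    exact ((continuous_certifiedDataset E t).tendsto _).comp
      (tendsto_const_nhds.prodMk_nhds (tendsto_const_nhds.prodMk_nhds hMn))
  refine mem_closure_of_tendsto hPlim ?_
  -- Discards the indices at which the total weight, the denominator of `s n`, vanishes.
  filter_upwards [hs.eventually_const_lt hpos] with n hn
  refine certifiedDataset_mem_softSpectralDatasets hA hE hp hp1 hpε (q := fun l => s n * c n l)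
    ?_ (he n) (fun a x => (hF x a).conjTranspose_mul_mul_same _) fun x => ?_
  · simp only [NNReal.coe_mul]
    rw [← Finset.mul_sum]
    simp only [s, NNReal.coe_div, NNReal.coe_sum, Real.coe_toNNReal _ (hp _)]
    exact div_mul_cancel₀ _ hn.ne'
  · change ∑ a, (S (D (g' n)))ᴴ * F x a * S (D (g' n)) = D (g' n)
    rw [← Matrix.sum_mul, ← Matrix.mul_sum, hF1, Matrix.mul_one, hS _ (hDn n)]

end Backward

end

theorem mainTheorem7 {N : ℕ} (t : Fin N → ℝ) :
    (∀ (A X m : ℕ) (E : Fin m → ℝ) (Eplus ε : ℝ), 0 < A →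
      (∀ k, 0 ≤ E k ∧ E k < Eplus) →
      ∀ P : Fin A → Fin X → Fin N → ℝ, IsDataset P →
      (P ∈ closure (softSpectralDatasets A X E Eplus ε t) ↔
        ∃ (p : Fin (m + 1) → ℝ) (γ : Matrix (Fin N) (Fin N) ℂ)
          (M : Fin A → Fin X → Matrix (Fin m ⊕ Fin N) (Fin m ⊕ Fin N) ℂ),
          (∀ k, 0 ≤ p k) ∧ ∑ k, p k = 1 ∧
          γ ∈ decayMatrices t ∧
          p (Fin.last m) ≤ ε ∧
          (∀ a x, (M a x).PosSemidef) ∧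
          (∀ x, ∑ a, M a x =
            Matrix.fromBlocks (Matrix.diagonal fun k : Fin m => (p k.castSucc : ℂ)) 0 0 γ) ∧
          ∀ a x j, (P a x j : ℂ) =
            star (probeVector E t j) ⬝ᵥ (M a x *ᵥ probeVector E t j))) ∧
    ∀ Eplus : ℝ, decayMatricesOn (Set.Ici Eplus) t = decayMatrices t := by
  refine ⟨fun A X m E Eplus ε hA hE P hP => ⟨fun h => ?_, ?_⟩, decayMatricesOn_Ici t⟩
  · obtain ⟨⟨p, γ, M⟩, ⟨hp, hp1, hγ, hpε, hM, hsum, -⟩, rfl⟩ :=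
      closure_minimal (softSpectralDatasets_subset_image hE) (isClosed_image_certifiedDataset E) h
    exact ⟨p, γ, M, hp, hp1, hγ, hpε, hM, hsum, fun a x j => certifiedDataset_apply (hM a x) j⟩
  · rintro ⟨p, γ, M, hp, hp1, hγ, hpε, hM, hsum, hPM⟩
    exact mem_closure_of_certificate hA hE hP hp hp1 hγ hpε hM hsum hPM
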